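/- **Setting.** Consider an episodic Markov decision process with finite state space $\mathscr S$, finite action space $\mathscr A$, transition probabilities $p$, rewards $r:\mathscr S\times\mathscr A\times\mathscr S\to[-r_{\max},r_{\max}]$ with $r_{\max}>0$, discount factor $\gamma\in(0,1)$, fixed start state $S_0$ and an absorbing terminal state $0$. Let $\{\pi_\theta(a|s):\theta\in\mathbb R^d\}$ be stochastic policies. Under $\pi_\theta$, $A_t\sim\pi_\theta(\cdot|S_t)$ and $S_{t+1}\sim p(\cdot|S_t,A_t)$; let $T$ be the first time at which state $0$ is visited, $R^\theta=\sum_{t=0}^{T-1}\gamma^t r(S_t,A_t,S_{t+1})$, $F_{R^\theta}$ its distribution function, and $M_r=\frac{r_{\max}}{1-\gamma}$. Let $g:[0,1]\to[0,1]$ be a distortion function (non-decreasing, $g(0)=0$, $g(1)=1$), and let $$\rho_g(\theta)=\int_{-M_r}^0\big(g(1-F_{R^\theta}(x))-1\big)\,dx+\int_0^{M_r}g(1-F_{R^\theta}(x))\,dx,\qquad \rho_g^*=\sup_{\theta\in\mathbb R^d}\rho_g(\theta).$$ **Algorithm (DRM-OnP-LR).** Fix $\theta_0\in\mathbb R^d$,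 a step-size $\alpha>0$, a batch size $m\ge1$ and a number of iterations $N\ge1$. For $k=0,\dots,N-1$, given the past, generate $m$ independent episodes with the policy $\pi_{\theta_k}$, with rewards $R_i$, lengths $T^i$, states $S^i_t$ and actions $A^i_t$ ($1\le i\le m$), and set $\theta_{k+1}=\theta_k+\alpha\,\widehat\nabla^G\rho_g(\theta_k)$, where, for $\theta=\theta_k$, $$\widehat\nabla^G\rho_g(\theta)=-\int_{-M_r}^{M_r}g'(1-G^m(x))\,\widehat\nabla G^m(x)\,dx,$$ $$G^m(x)=\frac1m\sum_{i=1}^m\mathbf 1\{R_i\le x\},\qquad \widehat\nabla G^m(x)=\frac1m\sum_{i=1}^m\mathbf 1\{R_i\le x\}\sum_{t=0}^{T^i-1}\nabla\log\pi_\theta(A^i_t|S^i_t).$$ Here $\nabla$ is the gradient in $\theta$, and $g'(0)$ is the right derivative of $g$ at $0$. (Where $G^m(x)=0$ the integrand is zero.) The output is $\theta_R$ with $R$ uniformly distributed on $\{1,\dots,N\}$ and independent of the iterates. **Theorem.** Assume that: 1. the policies are proper: there is $M>0$ such that $\max_{s\in\mathscr S}\mathbb P(S_M\ne0\mid S_0=s,\pi_\theta)<1$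 for all $\theta$; and $M_e>0$ is an upper bound on the episode length, that is, $T\le M_e$ almost surely under every $\pi_\theta$; 2. $\pi_\theta(a|s)>0$, and $\theta\mapsto\log\pi_\theta(a|s)$ is twice differentiable with $\|\nabla\log\pi_\theta(a|s)\|\le M_d$ (Euclidean norm) and $\|\nabla^2\log\pi_\theta(a|s)\|\le M_h$ (operator norm), for all $\theta,a,s$, where $M_d,M_h>0$; 3. $g$ is twice differentiable on $(0,1)$ with $|g'|\le M_{g'}$ and $|g''|\le M_{g''}$ there, where $M_{g'},M_{g''}>0$, and $g$ has a right derivative at $0$. Then $\rho_g$ is differentiable and bounded above, $\|\nabla\rho_g(\theta_R)\|^2$ is integrable, and $$\mathbb E\|\nabla\rho_g(\theta_R)\|^2\le\frac{2\left(\rho_g^*-\rho_g(\theta_0)\right)}{N\alpha}+4M_r^2M_e^2M_d^2\left(\alpha M_{g'}^2L_{\rho'}+\frac{8\left(e^2M_{g'}^2+M_{g''}^2\right)}{m}\right),$$ where $L_{\rho'}=2M_rM_e\left(M_hM_{g'}+M_eM_d^2(M_{g'}+M_{g''})\right)$. -/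

import Mathlib

open MeasureTheory ProbabilityTheory
open scoped ENNReal

noncomputable section

namespace DRM

/-- An episodic Markov decision process on a state space `S` and an action space `A`, with
bounded rewards, discount factor, fixed start state, and absorbing terminal state. -/
structure EpisodicMDP (S A : Type*) where
  /-- reward for the transition from `s` to `s'` under the action `a` -/
  reward : S → A → S → ℝ
  /-- bound on the rewards -/
  rMax : ℝ
  /-- transition law: `trans s a s'` is the probability of moving from `s` to `s'` under `a` -/
  trans : S → A → PMF S
  /-- discount factor -/
  γ : ℝ
  /-- the special absorbing state, at which episodes terminate -/
  term : S
  /-- the fixed start state of the episodes -/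
  start : S
  rMax_pos : 0 < rMax
  abs_reward_le : ∀ s a s', |reward s a s'| ≤ rMax
  γ_pos : 0 < γ
  γ_lt_one : γ < 1
  absorbing : ∀ a, trans term a = PMF.pure term

/-- The parameter space `ℝᵈ` with its Euclidean norm. -/
abbrev Param (d : ℕ) : Type := EuclideanSpace ℝ (Fin d)

/-- A parameterized family of stochastic policies: `π θ s a` is the probability `π_θ(a | s)`. -/
abbrev Policy (d : ℕ) (S A : Type*) : Type _ := Param d → S → PMF A

/-- A trajectory `(S₀, A₀), (S₁, A₁), …`. -/
abbrev Trajectory (S A : Type*) : Type _ := ℕ → S × A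

variable {S A : Type*} {d : ℕ}

section Law

variable [Finite S] [Finite A] [MeasurableSpace S] [MeasurableSpace A]
  [MeasurableSingletonClass S] [MeasurableSingletonClass A]

/-- The law of `(s, a)` with `a ∼ π_θ(· | s)`. -/
def stateActionLaw (π : Policy d S A) (θ : Param d) (s : S) : PMF (S × A) :=
  (π θ s).map (fun a => (s, a))

/-- One step of the chain: given the history up to time `n`, the next state is drawn from
`p(· | S_n, A_n)` and the next action from `π_θ(· | S_{n+1})`. -/
def stepKernel (M : EpisodicMDP S A) (π : Policy d S A) (θ : Param d) (n : ℕ) :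
    Kernel ((_ : Finset.Iic n) → S × A) (S × A) :=
  Kernel.ofFunOfCountable fun h =>
    let x := h ⟨n, Finset.mem_Iic.2 le_rfl⟩
    ((M.trans x.1 x.2).bind (stateActionLaw π θ)).toMeasure

instance (M : EpisodicMDP S A) (π : Policy d S A) (θ : Param d) (n : ℕ) :
    IsMarkovKernel (stepKernel M π θ n) :=
  ⟨fun _ => PMF.toMeasure.isProbabilityMeasure _⟩

/-- The law of the trajectory started at `S₀ = s` and controlled by the policy `π_θ`. -/
def trajLaw (M : EpisodicMDP S A) (π : Policy d S A) (θ : Param d) (s : S) :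
    Measure (Trajectory S A) :=
  Kernel.trajMeasure (X := fun _ => S × A) (stateActionLaw π θ s).toMeasure (stepKernel M π θ)

/-- The law of an episode: the trajectory starts at the fixed start state. -/
def episodeLaw (M : EpisodicMDP S A) (π : Policy d S A) (θ : Param d) :
    Measure (Trajectory S A) :=
  trajLaw M π θ M.start

/-- The policies are proper: there is a time `n > 0` such that, under every policy `π_θ`, from
every state, the terminal state is reached by time `n` with positive probability. -/
def IsProper (M : EpisodicMDP S A) (π : Policy d S A) : Prop :=
  ∃ n : ℕ, 0 < n ∧ ∀ θ s, trajLaw M π θ s {ω | (ω n).1 ≠ M.term} < 1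

end Law

section Episode

/-- The length `T` of an episode: the first time at which the terminal state is visited
(infinite if this never happens). -/
def episodeLength (M : EpisodicMDP S A) (ω : Trajectory S A) : ℕ∞ :=
  ⨅ (t : ℕ) (_ : (ω t).1 = M.term), (t : ℕ∞)

/-- The cumulative discounted reward `R = ∑_{t < T} γᵗ r(S_t, A_t, S_{t+1})` of an episode
of finite length. -/
def cumReward (M : EpisodicMDP S A) (ω : Trajectory S A) : ℝ :=
  ∑ t ∈ Finset.range (episodeLength M ω).toNat,
    M.γ ^ t * M.reward (ω t).1 (ω t).2 (ω (t + 1)).1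

/-- The log-likelihood `θ ↦ log π_θ(a | s)`. -/
def logPolicy (π : Policy d S A) (s : S) (a : A) (θ : Param d) : ℝ :=
  Real.log (π θ s a).toReal

/-- The sum `∑_{t < T} ∇ log π_θ(A_t | S_t)` over an episode of finite length. -/
def episodeScore (M : EpisodicMDP S A) (π : Policy d S A) (θ : Param d)
    (ω : Trajectory S A) : Param d :=
  ∑ t ∈ Finset.range (episodeLength M ω).toNat,
    gradient (logPolicy π (ω t).1 (ω t).2) θ

/-- The bound `M_r = r_max / (1 - γ)` on the cumulative reward. -/
def EpisodicMDP.rewardBound (M : EpisodicMDP S A) : ℝ := M.rMax / (1 - M.γ)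

end Episode

section Distortion

/-- `g` (restricted to `[0,1]`) is a distortion function. -/
structure IsDistortion (g : ℝ → ℝ) : Prop where
  mapsTo : Set.MapsTo g (Set.Icc 0 1) (Set.Icc 0 1)
  mono : MonotoneOn g (Set.Icc 0 1)
  zero : g 0 = 0
  one : g 1 = 1

variable [Finite S] [Finite A] [MeasurableSpace S] [MeasurableSpace A]
  [MeasurableSingletonClass S] [MeasurableSingletonClass A]

/-- The cumulative distribution function of the cumulative reward `R^θ`. -/
def rewardCDF (M : EpisodicMDP S A) (π : Policy d S A) (θ : Param d) (x : ℝ) : ℝ :=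
  (episodeLaw M π θ).real {ω | cumReward M ω ≤ x}

/-- The distortion risk measure `ρ_g(θ)` of the cumulative reward. -/
def drm (M : EpisodicMDP S A) (π : Policy d S A) (g : ℝ → ℝ) (θ : Param d) : ℝ :=
  (∫ x in (-M.rewardBound)..0, (g (1 - rewardCDF M π θ x) - 1)) +
    ∫ x in (0)..M.rewardBound, g (1 - rewardCDF M π θ x)

end Distortion

section Estimator

/-- The empirical distribution function of the rewards of `m` episodes. -/
def empCDF (M : EpisodicMDP S A) {m : ℕ} (w : Fin m → Trajectory S A) (x : ℝ) : ℝ :=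
  (m : ℝ)⁻¹ * ∑ i, Set.indicator {ω | cumReward M ω ≤ x} (fun _ => (1 : ℝ)) (w i)

/-- The likelihood-ratio estimate, from `m` episodes, of the gradient in `θ` of the distribution
function of `R^θ` at `x`. -/
def gradEmpCDF (M : EpisodicMDP S A) (π : Policy d S A) (θ : Param d) {m : ℕ}
    (w : Fin m → Trajectory S A) (x : ℝ) : Param d :=
  (m : ℝ)⁻¹ • ∑ i, Set.indicator {ω | cumReward M ω ≤ x} (episodeScore M π θ) (w i)

/-- The estimate of `∇ρ_g(θ)` from `m` episodes. The derivative of `g` is taken within `[0,1]`,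
so it is the usual one in `(0,1)` and the right derivative at `0`; at `1` its value is
multiplied by the zero vector. -/
def gradEstimate (M : EpisodicMDP S A) (π : Policy d S A) (g : ℝ → ℝ) (θ : Param d) {m : ℕ}
    (w : Fin m → Trajectory S A) : Param d :=
  -∫ x in (-M.rewardBound)..M.rewardBound,
    derivWithin g (Set.Icc 0 1) (1 - empCDF M w x) • gradEmpCDF M π θ w x

end Estimator

section Algorithm

variable [Finite S] [Finite A] [MeasurableSpace S] [MeasurableSpace A]
  [MeasurableSingletonClass S] [MeasurableSingletonClass A]

/-- The law of a batch of `m` independent episodes generated by the policy `π_θ`. -/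
def batchLaw (M : EpisodicMDP S A) (π : Policy d S A) (m : ℕ) (θ : Param d) :
    Measure (Fin m → Trajectory S A) :=
  Measure.pi fun _ => episodeLaw M π θ

/-- A run of `N` iterations of the on-policy likelihood-ratio DRM gradient ascent with step-size
`α` and batch size `m`, started at `θ₀`, on a probability space with a filtration `ℱ`:
`θ k` is the `k`-th iterate, `W k` is the batch of episodes generated in iteration `k`, and `R` is
the index of the output. -/
structure IsRun (M : EpisodicMDP S A) (π : Policy d S A) (g : ℝ → ℝ) (N m : ℕ) (α : ℝ)
    (θ₀ : Param d) {Ω : Type*} [mΩ : MeasurableSpace Ω] (P : Measure Ω)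
    (ℱ : Filtration ℕ mΩ)
    (W : ℕ → Ω → Fin m → Trajectory S A) (θ : ℕ → Ω → Param d) (R : Ω → ℕ) : Prop where
  init : ∀ ω, θ 0 ω = θ₀
  update : ∀ k < N, ∀ ω, θ (k + 1) ω = θ k ω + α • gradEstimate M π g (θ k ω) (W k ω)
  measurable_iterate : ∀ k ≤ N, Measurable[ℱ k] (θ k)
  measurable_batch : ∀ k < N, Measurable[ℱ (k + 1)] (W k)
  /-- Given the past, the `k`-th batch consists of `m` independent episodes generated by the
  policy `π_{θ_k}`. -/
  batch_law : ∀ k < N, ∀ E : Set Ω, MeasurableSet[ℱ k] E →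
    ∀ B : Set (Fin m → Trajectory S A), MeasurableSet B →
      P (E ∩ W k ⁻¹' B) = ∫⁻ ω in E, batchLaw M π m (θ k ω) B ∂P
  measurable_index : Measurable R
  /-- The index of the output is uniformly distributed on `{1, …, N}` … -/
  index_uniform : ∀ k ∈ Finset.Icc 1 N, P (R ⁻¹' {k}) = (N : ℝ≥0∞)⁻¹
  /-- … and independent of the iterates. -/
  index_indep : IndepFun R (fun ω (k : Fin N) => θ (k + 1) ω) P

end Algorithm

/-- The Lipschitz constant `L_{ρ'}` of the gradient of the distortion risk measure. -/
def smoothConst (Mr Me Md Mh Mg' Mg'' : ℝ) : ℝ :=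
  2 * Mr * Me * (Mh * Mg' + Me * Md ^ 2 * (Mg' + Mg''))

end DRM

end

/-!
Since the length of the episodes is bounded, an episode is one of finitely many weighted paths: up
to a null event, its law is a family `p θ` of weights on a finite set, and the score of a path is
the gradient of its log-likelihood. The distortion risk measure is then a finite sum
`∑ len V * g (1 - ∑ h ∈ V, p θ h)`, up to a constant, where `V` runs through sets of paths and
`len V` is the length of the set of thresholds `x` for which `V` is the event `R ≤ x`. The score
bounds make its gradient bounded and Lipschitz, with `g'` extended from `(0,1)` to a bounded
Lipschitz function on the line.

The gradient estimate is the same finite sum with the empirical frequencies of the batch in place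
of the weights. As empirical means of `m` independent samples have variance of order `1 / m`, its
mean squared error is of order `1 / m` as well. If `α * L ≤ 1`, the ascent inequality
`f (x + α e) ≥ f x + α / 2 * ‖f' x‖² - α / 2 * ‖e - f' x‖²` can be summed over the iterations. The
gradient at the last iterate, which is not controlled by a further step, is bounded by
`‖f' x‖² ≤ 2 L (sup f - f x)`. If `α * L > 1`, then the term `α * L * G ^ 2` of the bound already
exceeds `‖f'‖² ≤ G²`.
-/

namespace DRM

open scoped NNReal

section Ascent

variable {E : Type*} [NormedAddCommGroup E] [InnerProductSpace ℝ E] [CompleteSpace E]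
  {f : E → ℝ} {f' : E → E} {L : ℝ≥0} {b α : ℝ}

lemma add_inner_sub_le_of_lipschitzWith_gradient (hf : ∀ x, HasGradientAt f (f' x) x)
    (hL : LipschitzWith L f') (x v : E) :
    f x + inner ℝ (f' x) v - L / 2 * ‖v‖ ^ 2 ≤ f (x + v) := by
  let ψ : ℝ → ℝ := fun t => f (x + t • v) - t * inner ℝ (f' x) v + L / 2 * t ^ 2 * ‖v‖ ^ 2
  have hψ : ∀ t, HasDerivAt ψ
      (inner ℝ (f' (x + t • v)) v - inner ℝ (f' x) v + L * t * ‖v‖ ^ 2) t := by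
    intro t
    have hline : HasDerivAt (fun t : ℝ => x + t • v) v t := by
      simpa using ((hasDerivAt_id t).smul_const v).const_add x
    have hfline : HasDerivAt (fun t : ℝ => f (x + t • v)) (inner ℝ (f' (x + t • v)) v) t :=
      (hf (x + t • v)).hasFDerivAt.comp_hasDerivAt (f := fun t : ℝ => x + t • v) t hline
    refine ((hfline.sub ((hasDerivAt_id t).mul_const (inner ℝ (f' x) v))).add
      ((((hasDerivAt_id t).pow 2).const_mul (L / 2 : ℝ)).mul_const (‖v‖ ^ 2))).congr_deriv ?_
    simp only [id]
    ring
  have hmono : MonotoneOn ψ (Set.Icc 0 1) := by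
    refine monotoneOn_of_hasDerivWithinAt_nonneg (convex_Icc 0 1)
      (fun t _ => (hψ t).continuousAt.continuousWithinAt)
      (fun t _ => (hψ t).hasDerivWithinAt) fun t ht => ?_
    rw [interior_Icc] at ht
    have hdist : ‖f' (x + t • v) - f' x‖ ≤ L * (t * ‖v‖) := by
      simpa [norm_smul, abs_of_pos ht.1] using hL.norm_sub_le (x + t • v) x
    have hinner := neg_le_of_abs_le (abs_real_inner_le_norm (f' (x + t • v) - f' x) v)
    rw [← inner_sub_left]
    nlinarith [mul_le_mul_of_nonneg_right hdist (norm_nonneg v)]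
  have h := hmono (Set.left_mem_Icc.2 zero_le_one) (Set.right_mem_Icc.2 zero_le_one) zero_le_one
  simp only [ψ, zero_smul, add_zero, one_smul] at h
  linarith

lemma add_norm_sq_sub_norm_sq_le_gradient_step (hf : ∀ x, HasGradientAt f (f' x) x)
    (hL : LipschitzWith L f') (hα : 0 ≤ α) (hαL : α * L ≤ 1) (x e : E) :
    f x + α / 2 * ‖f' x‖ ^ 2 - α / 2 * ‖e - f' x‖ ^ 2 ≤ f (x + α • e) := by
  have hdescent := add_inner_sub_le_of_lipschitzWith_gradient hf hL x (α • e)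
  rw [inner_smul_right, norm_smul, Real.norm_of_nonneg hα, mul_pow] at hdescent
  have hpolar := norm_sub_sq_real e (f' x)
  rw [real_inner_comm] at hpolar
  have hrest : 0 ≤ α / 2 * (1 - α * L) * ‖e‖ ^ 2 :=
    mul_nonneg (mul_nonneg (by linarith) (by linarith)) (sq_nonneg _)
  rw [hpolar]
  linarith

lemma half_mul_norm_sq_gradient_le_sub (hf : ∀ x, HasGradientAt f (f' x) x)
    (hL : LipschitzWith L f') (hα : 0 ≤ α) (hαL : α * L ≤ 1) (hb : ∀ x, f x ≤ b) (x : E) :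
    α / 2 * ‖f' x‖ ^ 2 ≤ b - f x := by
  have hstep := add_norm_sq_sub_norm_sq_le_gradient_step hf hL hα hαL x (f' x)
  rw [sub_self, norm_zero] at hstep
  linarith [hb (x + α • f' x)]

end Ascent

section StochasticAscent

variable {Ω : Type*} {mΩ : MeasurableSpace Ω} {P : Measure Ω}

section IndependentIndex

variable {ι : Type*} {s : Finset ι} {R : Ω → ι} {Y : ι → Ω → ℝ}

lemma comp_index_ae_eq_sum_indicator (hRs : ∀ᵐ ω ∂P, R ω ∈ s) :
    (fun ω => Y (R ω) ω) =ᵐ[P] fun ω => ∑ i ∈ s, (R ⁻¹' {i}).indicator (Y i) ω := by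
  filter_upwards [hRs] with ω hω
  rw [Finset.sum_eq_single_of_mem _ hω fun i _ hi =>
    Set.indicator_of_notMem (by simpa using hi.symm) _]
  simp

variable [MeasurableSpace ι] [MeasurableSingletonClass ι]

lemma integrable_comp_index (hR : Measurable R) (hRs : ∀ᵐ ω ∂P, R ω ∈ s)
    (hY : ∀ i ∈ s, Integrable (Y i) P) : Integrable (fun ω => Y (R ω) ω) P :=
  (integrable_finsetSum s fun i hi =>
    (hY i hi).indicator (hR (measurableSet_singleton i))).congr
      (comp_index_ae_eq_sum_indicator hRs).symm

lemma integral_comp_index (hR : Measurable R) (hRs : ∀ᵐ ω ∂P, R ω ∈ s)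
    (hY : ∀ i ∈ s, Integrable (Y i) P) (hindep : ∀ i ∈ s, IndepFun R (Y i) P) :
    ∫ ω, Y (R ω) ω ∂P = ∑ i ∈ s, P.real (R ⁻¹' {i}) * ∫ ω, Y i ω ∂P := by
  have hms : ∀ i, MeasurableSet (R ⁻¹' {i}) := fun i => hR (measurableSet_singleton i)
  rw [integral_congr_ae (comp_index_ae_eq_sum_indicator hRs),
    integral_finsetSum _ fun i hi => (hY i hi).indicator (hms i)]
  refine Finset.sum_congr rfl fun i hi => ?_
  rw [integral_indicator (hms i)]
  exact ((IndepFun_iff_Indep ..).1 (hindep i hi)).setIntegral_eq_mul hR.comap_le (f := id)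
    (hY i hi).aemeasurable ⟨{i}, measurableSet_singleton i, rfl⟩ aestronglyMeasurable_id

lemma ae_mem_of_uniform_index [IsProbabilityMeasure P] (hs : s.Nonempty) (hR : Measurable R)
    (hunif : ∀ i ∈ s, P (R ⁻¹' {i}) = (s.card : ℝ≥0∞)⁻¹) : ∀ᵐ ω ∂P, R ω ∈ s := by
  have hms : MeasurableSet (R ⁻¹' (s : Set ι)) := hR s.measurableSet
  refine (mem_ae_iff_prob_eq_one hms).2 ?_
  rw [← sum_measure_preimage_singleton _ fun i _ => hR (measurableSet_singleton i),
    Finset.sum_congr rfl hunif, Finset.sum_const, nsmul_eq_mul,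
    ENNReal.mul_inv_cancel (by simpa using hs.ne_empty) (by simp)]

lemma integral_comp_uniform_index [IsProbabilityMeasure P] (hs : s.Nonempty) (hR : Measurable R)
    (hunif : ∀ i ∈ s, P (R ⁻¹' {i}) = (s.card : ℝ≥0∞)⁻¹)
    (hY : ∀ i ∈ s, Integrable (Y i) P) (hindep : ∀ i ∈ s, IndepFun R (Y i) P) :
    ∫ ω, Y (R ω) ω ∂P = (s.card : ℝ)⁻¹ * ∑ i ∈ s, ∫ ω, Y i ω ∂P := by
  rw [integral_comp_index hR (ae_mem_of_uniform_index hs hR hunif) hY hindep, Finset.mul_sum]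
  exact Finset.sum_congr rfl fun i hi => by simp [measureReal_def, hunif i hi]

end IndependentIndex

lemma setLIntegral_eq_lintegral_mul_of_forall_measure {m₀ : MeasurableSpace Ω} (hm : m₀ ≤ mΩ)
    {D : Set Ω} {q Z : Ω → ℝ≥0∞} (hq : Measurable[m₀] q) (hZ : Measurable[m₀] Z)
    (hlaw : ∀ F : Set Ω, MeasurableSet[m₀] F → P (F ∩ D) = ∫⁻ ω in F, q ω ∂P) :
    ∫⁻ ω in D, Z ω ∂P = ∫⁻ ω, q ω * Z ω ∂P := by
  have htrim : (P.restrict D).trim hm = (P.withDensity q).trim hm := by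
    refine @Measure.ext Ω m₀ _ _ fun F hF => ?_
    rw [trim_measurableSet_eq hm hF, trim_measurableSet_eq hm hF,
      Measure.restrict_apply (hm F hF), withDensity_apply _ (hm F hF), hlaw F hF]
  rw [← lintegral_trim hm hZ, htrim, lintegral_trim hm hZ,
    lintegral_withDensity_eq_lintegral_mul P (hq.mono hm le_rfl) (hZ.mono hm le_rfl)]
  rfl

lemma lintegral_le_lintegral_sum_mul {ι : Type*} [Fintype ι] {m₀ : MeasurableSpace Ω}
    (hm : m₀ ≤ mΩ) {D : ι → Set Ω} (hD : ∀ᵐ ω ∂P, ∃ i, ω ∈ D i) {q Z : ι → Ω → ℝ≥0∞}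
    (hq : ∀ i, Measurable[m₀] (q i)) (hZ : ∀ i, Measurable[m₀] (Z i))
    (hlaw : ∀ i, ∀ F : Set Ω, MeasurableSet[m₀] F → P (F ∩ D i) = ∫⁻ ω in F, q i ω ∂P)
    {Y : Ω → ℝ≥0∞} (hY : ∀ i, ∀ ω ∈ D i, Y ω ≤ Z i ω) :
    ∫⁻ ω, Y ω ∂P ≤ ∫⁻ ω, ∑ i, q i ω * Z i ω ∂P := by
  have hcover : ∀ᵐ ω ∂P, ω ∈ ⋃ i, D i := by simpa only [Set.mem_iUnion] using hD
  calc ∫⁻ ω, Y ω ∂P = ∫⁻ ω in ⋃ i, D i, Y ω ∂P := by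
        rw [Measure.restrict_eq_self_of_ae_mem hcover]
    _ ≤ ∑ i, ∫⁻ ω in D i, Y ω ∂P := (lintegral_iUnion_le _ _).trans_eq (tsum_fintype _)
    _ ≤ ∑ i, ∫⁻ ω in D i, Z i ω ∂P :=
        Finset.sum_le_sum fun i _ => setLIntegral_mono ((hZ i).mono hm le_rfl) (hY i)
    _ = ∫⁻ ω, ∑ i, q i ω * Z i ω ∂P := by
        rw [lintegral_finsetSum]
        · exact Finset.sum_congr rfl fun i _ =>
            setLIntegral_eq_lintegral_mul_of_forall_measure hm (hq i) (hZ i) (hlaw i)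
        · exact fun i _ => ((hq i).mul (hZ i)).mono hm le_rfl

lemma integrable_norm_sq_comp {E F : Type*} [TopologicalSpace E] [MeasurableSpace E]
    [BorelSpace E] [NormedAddCommGroup F] {φ : E → F} (hφ : Continuous φ) {G : ℝ}
    (hG : ∀ x, ‖φ x‖ ≤ G) [IsFiniteMeasure P] {y : Ω → E} (hy : Measurable y) :
    Integrable (fun ω => ‖φ (y ω)‖ ^ 2) P :=
  .of_mem_Icc 0 (G ^ 2) ((hφ.norm.pow 2).measurable.comp hy).aemeasurable
    (ae_of_all _ fun _ => ⟨sq_nonneg _, pow_le_pow_left₀ (norm_nonneg _) (hG _) 2⟩)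

variable {E : Type*} [NormedAddCommGroup E] [InnerProductSpace ℝ E] [CompleteSpace E]
  {f : E → ℝ} {f' : E → E} {L : ℝ≥0} {b α σ : ℝ}

lemma integral_gradient_step_le (hf : ∀ x, HasGradientAt f (f' x) x) (hL : LipschitzWith L f')
    (hα : 0 ≤ α) (hαL : α * L ≤ 1) {x e : Ω → E} (hfx : Integrable (fun ω => f (x ω)) P)
    (hgrad : Integrable (fun ω => ‖f' (x ω)‖ ^ 2) P)
    (herr : Integrable (fun ω => ‖e ω - f' (x ω)‖ ^ 2) P)
    (hstep : Integrable (fun ω => f (x ω + α • e ω)) P) :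
    ∫ ω, f (x ω) ∂P + α / 2 * ∫ ω, ‖f' (x ω)‖ ^ 2 ∂P -
      α / 2 * ∫ ω, ‖e ω - f' (x ω)‖ ^ 2 ∂P ≤ ∫ ω, f (x ω + α • e ω) ∂P := by
  have hsum : Integrable (fun ω => f (x ω) + α / 2 * ‖f' (x ω)‖ ^ 2) P :=
    hfx.add (hgrad.const_mul _)
  rw [← integral_const_mul, ← integral_const_mul, ← integral_add hfx (hgrad.const_mul _),
    ← integral_sub hsum (herr.const_mul _)]
  exact integral_mono (hsum.sub (herr.const_mul _)) hstep fun ω =>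
    add_norm_sq_sub_norm_sq_le_gradient_step hf hL hα hαL (x ω) (e ω)

variable [IsProbabilityMeasure P] {N : ℕ} {x e : ℕ → Ω → E} {x₀ : E} {R : Ω → ℕ} {G : ℝ}

lemma half_mul_sum_integral_norm_sq_gradient_le (hf : ∀ x, HasGradientAt f (f' x) x)
    (hL : LipschitzWith L f') (hα : 0 ≤ α) (hαL : α * L ≤ 1) (hb : ∀ x, f x ≤ b)
    (hx₀ : ∀ ω, x 0 ω = x₀) (hx : ∀ k < N, ∀ ω, x (k + 1) ω = x k ω + α • e k ω)
    (hfx : ∀ k ≤ N, Integrable (fun ω => f (x k ω)) P)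
    (hgrad : ∀ k ≤ N, Integrable (fun ω => ‖f' (x k ω)‖ ^ 2) P)
    (herr : ∀ k < N, Integrable (fun ω => ‖e k ω - f' (x k ω)‖ ^ 2) P)
    (hσ : ∀ k < N, ∫ ω, ‖e k ω - f' (x k ω)‖ ^ 2 ∂P ≤ σ) :
    α / 2 * ∑ k ∈ Finset.Icc 1 N, ∫ ω, ‖f' (x k ω)‖ ^ 2 ∂P ≤ b - f x₀ + N * (α / 2 * σ) := by
  let F : ℕ → ℝ := fun k => ∫ ω, f (x k ω) ∂P
  let s : ℕ → ℝ := fun k => ∫ ω, ‖f' (x k ω)‖ ^ 2 ∂P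
  have hstep : ∀ k ∈ Finset.range N, α / 2 * s k ≤ F (k + 1) - F k + α / 2 * σ := by
    intro k hk
    have hkN := Finset.mem_range.1 hk
    have hmono := integral_gradient_step_le hf hL hα hαL (hfx k hkN.le) (hgrad k hkN.le)
      (herr k hkN) (by simpa only [hx k hkN] using hfx (k + 1) hkN)
    simp_rw [← hx k hkN] at hmono
    linarith [mul_le_mul_of_nonneg_left (hσ k hkN) (by linarith : 0 ≤ α / 2)]
  have hlast : α / 2 * s N ≤ b - F N := by
    have hint := integral_mono ((hgrad N le_rfl).const_mul (α / 2))
      ((integrable_const b).sub (hfx N le_rfl))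
      fun ω => half_mul_norm_sq_gradient_le_sub hf hL hα hαL hb (x N ω)
    simpa [integral_const_mul, integral_sub (integrable_const b) (hfx N le_rfl)] using hint
  have hF₀ : F 0 = f x₀ := by simp [F, hx₀]
  calc α / 2 * ∑ k ∈ Finset.Icc 1 N, s k ≤ α / 2 * ∑ k ∈ Finset.range (N + 1), s k := by
        refine mul_le_mul_of_nonneg_left (Finset.sum_le_sum_of_subset_of_nonneg ?_ ?_) (by linarith)
        · exact fun k hk => Finset.mem_range.2 (by grind)
        · exact fun k _ _ => integral_nonneg fun ω => sq_nonneg ‖f' (x k ω)‖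
    _ = ∑ k ∈ Finset.range N, α / 2 * s k + α / 2 * s N := by
        rw [Finset.sum_range_succ, mul_add, Finset.mul_sum]
    _ ≤ ∑ k ∈ Finset.range N, (F (k + 1) - F k + α / 2 * σ) + (b - F N) :=
        add_le_add (Finset.sum_le_sum hstep) hlast
    _ = b - f x₀ + N * (α / 2 * σ) := by
        rw [Finset.sum_add_distrib, Finset.sum_range_sub, Finset.sum_const, Finset.card_range,
          nsmul_eq_mul, hF₀]
        ring

variable [MeasurableSpace E] [BorelSpace E] [SecondCountableTopology E] {a : ℝ}

theorem half_mul_sum_integral_norm_sq_gradient_le_of_lintegral_le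
    (hf : ∀ x, HasGradientAt f (f' x) x) (hL : LipschitzWith L f')
    (hfab : ∀ x, f x ∈ Set.Icc a b) (hG : ∀ x, ‖f' x‖ ≤ G)
    (hα : 0 ≤ α) (hαL : α * L ≤ 1) (hσ : 0 ≤ σ)
    (hx₀ : ∀ ω, x 0 ω = x₀) (hx : ∀ k < N, ∀ ω, x (k + 1) ω = x k ω + α • e k ω)
    (hxm : ∀ k ≤ N, Measurable (x k)) (hem : ∀ k < N, Measurable (e k))
    (herr : ∀ k < N, ∫⁻ ω, ENNReal.ofReal (‖e k ω - f' (x k ω)‖ ^ 2) ∂P ≤ ENNReal.ofReal σ) :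
    α / 2 * ∑ k ∈ Finset.Icc 1 N, ∫ ω, ‖f' (x k ω)‖ ^ 2 ∂P ≤ b - f x₀ + N * (α / 2 * σ) := by
  have hfm : Measurable f :=
    (continuous_iff_continuousAt.2 fun x => (hf x).continuousAt).measurable
  have herrm : ∀ k < N, AEStronglyMeasurable (fun ω => ‖e k ω - f' (x k ω)‖ ^ 2) P :=
    fun k hk => (((hem k hk).sub (hL.continuous.measurable.comp (hxm k hk.le))).norm.pow_const
      2).aestronglyMeasurable
  refine half_mul_sum_integral_norm_sq_gradient_le hf hL hα hαL (fun x => (hfab x).2) hx₀ hx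
    (fun k hk => .of_mem_Icc a b (hfm.comp (hxm k hk)).aemeasurable (ae_of_all _ fun ω => hfab _))
    (fun k hk => integrable_norm_sq_comp hL.continuous hG (hxm k hk))
    (fun k hk => ⟨herrm k hk, ?_⟩) fun k hk => ?_
  · rw [hasFiniteIntegral_iff_ofReal (ae_of_all _ fun ω => sq_nonneg _)]
    exact (herr k hk).trans_lt ENNReal.ofReal_lt_top
  · rw [integral_eq_lintegral_of_nonneg_ae (ae_of_all _ fun ω => sq_nonneg _) (herrm k hk)]
    exact ENNReal.toReal_le_of_le_ofReal hσ (herr k hk)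

theorem integral_norm_sq_gradient_comp_index_le
    (hf : ∀ x, HasGradientAt f (f' x) x) (hL : LipschitzWith L f')
    (hfab : ∀ x, f x ∈ Set.Icc a b) (hG : ∀ x, ‖f' x‖ ≤ G)
    (hN : 1 ≤ N) (hα : 0 < α) (hσ : 0 ≤ σ)
    (hx₀ : ∀ ω, x 0 ω = x₀) (hx : ∀ k < N, ∀ ω, x (k + 1) ω = x k ω + α • e k ω)
    (hxm : ∀ k ≤ N, Measurable (x k)) (hem : ∀ k < N, Measurable (e k))
    (herr : ∀ k < N, ∫⁻ ω, ENNReal.ofReal (‖e k ω - f' (x k ω)‖ ^ 2) ∂P ≤ ENNReal.ofReal σ)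
    (hR : Measurable R) (hunif : ∀ k ∈ Finset.Icc 1 N, P (R ⁻¹' {k}) = (N : ℝ≥0∞)⁻¹)
    (hindep : ∀ k ∈ Finset.Icc 1 N, IndepFun R (x k) P) :
    Integrable (fun ω => ‖f' (x (R ω) ω)‖ ^ 2) P ∧
      ∫ ω, ‖f' (x (R ω) ω)‖ ^ 2 ∂P ≤ 2 * (b - f x₀) / (N * α) + (α * L * G ^ 2 + σ) := by
  have hs : (Finset.Icc 1 N).Nonempty := Finset.nonempty_Icc.2 hN
  have hcard : (Finset.Icc 1 N).card = N := by simp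
  replace hunif : ∀ k ∈ Finset.Icc 1 N, P (R ⁻¹' {k}) = ((Finset.Icc 1 N).card : ℝ≥0∞)⁻¹ := by
    rwa [hcard]
  have hint : ∀ k ∈ Finset.Icc 1 N, Integrable (fun ω => ‖f' (x k ω)‖ ^ 2) P := fun k hk =>
    integrable_norm_sq_comp hL.continuous hG (hxm k (Finset.mem_Icc.1 hk).2)
  have hintR := integrable_comp_index (Y := fun k ω => ‖f' (x k ω)‖ ^ 2) hR
    (ae_mem_of_uniform_index hs hR hunif) hint
  have hgap : 0 ≤ 2 * (b - f x₀) / (N * α) := by positivity [sub_nonneg.2 (hfab x₀).2]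
  refine ⟨hintR, ?_⟩
  rcases le_or_gt (α * L) 1 with hαL | hαL
  · have hsum := half_mul_sum_integral_norm_sq_gradient_le_of_lintegral_le hf hL hfab hG hα.le hαL
      hσ hx₀ hx hxm hem herr
    have hmean := integral_comp_uniform_index (Y := fun k ω => ‖f' (x k ω)‖ ^ 2) hs hR hunif hint
      fun k hk => (hindep k hk).comp (ψ := fun y => ‖f' y‖ ^ 2) measurable_id
        (hL.continuous.norm.pow 2).measurable
    rw [hmean, hcard]
    calc (N : ℝ)⁻¹ * ∑ k ∈ Finset.Icc 1 N, ∫ ω, ‖f' (x k ω)‖ ^ 2 ∂P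
        = 2 / (N * α) * (α / 2 * ∑ k ∈ Finset.Icc 1 N, ∫ ω, ‖f' (x k ω)‖ ^ 2 ∂P) := by
          field_simp
      _ ≤ 2 / (N * α) * (b - f x₀ + N * (α / 2 * σ)) := by gcongr
      _ = 2 * (b - f x₀) / (N * α) + σ := by field_simp
      _ ≤ _ := by gcongr; exact le_add_of_nonneg_left (by positivity)
  · calc ∫ ω, ‖f' (x (R ω) ω)‖ ^ 2 ∂P ≤ ∫ _, G ^ 2 ∂P :=
          integral_mono hintR (integrable_const _) fun _ =>
            pow_le_pow_left₀ (norm_nonneg _) (hG _) 2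
      _ ≤ α * L * G ^ 2 := by simpa using le_mul_of_one_le_left (sq_nonneg G) hαL.le
      _ ≤ _ := by linarith

end StochasticAscent

section TrajectoryLaw

variable {X : ℕ → Type*} [∀ n, MeasurableSpace (X n)] (μ₀ : Measure (X 0))
  (κ : (n : ℕ) → Kernel (Π i : Finset.Iic n, X i) (X (n + 1))) [∀ n, IsMarkovKernel (κ n)]

lemma map_eval_zero_trajMeasure : (Kernel.trajMeasure μ₀ κ).map (fun ω => ω 0) = μ₀ := by
  let e : X 0 ≃ᵐ (Π i : Finset.Iic 0, X i) :=
    (MeasurableEquiv.piUnique (fun i : Finset.Iic 0 => X i)).symm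
  have heval : (fun ω : Π n, X n => ω 0) = e.symm ∘ Preorder.frestrictLe 0 := rfl
  rw [heval, ← Measure.map_map e.symm.measurable (by fun_prop), Kernel.trajMeasure,
    Measure.map_comp _ _ (by fun_prop), Kernel.traj_map_frestrictLe, Kernel.partialTraj_self,
    Measure.id_comp]
  exact (Measure.map_map e.symm.measurable e.measurable).trans Measure.map_id

lemma trajMeasure_cylinder_inter_succ [IsProbabilityMeasure μ₀]
    [∀ n, MeasurableSingletonClass (X n)] (n : ℕ) (y : Π n, X n)
    {B : Set (X (n + 1))} (hB : MeasurableSet B) :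
    Kernel.trajMeasure μ₀ κ {ω | (∀ t ≤ n, ω t = y t) ∧ ω (n + 1) ∈ B} =
      Kernel.trajMeasure μ₀ κ {ω | ∀ t ≤ n, ω t = y t} * κ n (Preorder.frestrictLe n y) B := by
  have hcyl : {ω : Π n, X n | ∀ t ≤ n, ω t = y t} =
      Preorder.frestrictLe n ⁻¹' {Preorder.frestrictLe n y} := by
    ext ω
    simp [funext_iff, Preorder.frestrictLe]
  have hsucc : {ω : Π n, X n | (∀ t ≤ n, ω t = y t) ∧ ω (n + 1) ∈ B} =
      (fun ω => (Preorder.frestrictLe n ω, ω (n + 1))) ⁻¹' ({Preorder.frestrictLe n y} ×ˢ B) := by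
    ext ω
    simp [funext_iff, Preorder.frestrictLe]
  have hms : MeasurableSet {Preorder.frestrictLe (π := X) n y} := measurableSet_singleton _
  rw [hcyl, hsucc, ← Measure.map_apply (by fun_prop) (hms.prod hB),
    ← Kernel.map_frestrictLe_trajMeasure_compProd_eq_map_trajMeasure,
    Measure.compProd_apply_prod hms hB, lintegral_singleton, Measure.map_apply (by fun_prop) hms,
    mul_comm]

end TrajectoryLaw

section StateActionLaw

variable {S A : Type*} {d : ℕ} (π : Policy d S A) (θ : Param d) (q : PMF S)

lemma bind_stateActionLaw_apply (x : S × A) :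
    q.bind (stateActionLaw π θ) x = q x.1 * π θ x.1 x.2 := by
  classical
  rw [PMF.bind_apply, tsum_eq_single x.1]
  · rw [stateActionLaw, PMF.map_apply, tsum_eq_single x.2 (by grind), if_pos rfl]
  · intro s hs
    rw [stateActionLaw, PMF.map_apply, ENNReal.tsum_eq_zero.2 (by grind), mul_zero]

lemma map_fst_bind_stateActionLaw : (q.bind (stateActionLaw π θ)).map Prod.fst = q := by
  simp only [PMF.map_bind, stateActionLaw, PMF.map_comp]
  exact (congrArg q.bind (funext fun s => PMF.map_const _ s)).trans q.bind_pure

variable [MeasurableSpace S] [MeasurableSpace A] [MeasurableSingletonClass S]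

lemma toMeasure_bind_stateActionLaw_singleton [MeasurableSingletonClass A] (x : S × A) :
    (q.bind (stateActionLaw π θ)).toMeasure {x} = q x.1 * π θ x.1 x.2 := by
  rw [PMF.toMeasure_apply_singleton _ _ (measurableSet_singleton x), bind_stateActionLaw_apply]

lemma toMeasure_bind_stateActionLaw_fst_eq (s : S) :
    (q.bind (stateActionLaw π θ)).toMeasure {x | x.1 = s} = q s := by
  rw [← PMF.toMeasure_apply_singleton q s (measurableSet_singleton s)]
  nth_rw 2 [← map_fst_bind_stateActionLaw π θ q]
  exact (PMF.toMeasure_map_apply _ _ _ measurable_fst (measurableSet_singleton s)).symm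

end StateActionLaw

section Truncation

variable {S A : Type*} {d : ℕ} {M : EpisodicMDP S A} {ω ω' y : Trajectory S A} {a₀ : A} {T : ℕ}

lemma episodeLength_eq_iff :
    episodeLength M ω = T ↔ (ω T).1 = M.term ∧ ∀ t < T, (ω t).1 ≠ M.term := by
  have hle : ∀ t, (ω t).1 = M.term → episodeLength M ω ≤ t := fun t ht => iInf₂_le t ht
  constructor
  · intro h
    have hne : ∀ t < T, (ω t).1 ≠ M.term := fun t ht hterm => by
      have := h ▸ hle t hterm
      exact absurd (Nat.cast_le.1 this) (by omega)
    refine ⟨by_contra fun hT => ?_, hne⟩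
    have hsucc : ((T + 1 : ℕ) : ℕ∞) ≤ episodeLength M ω := le_iInf₂ fun t ht =>
      Nat.cast_le.2 (by by_contra; grind)
    rw [h, Nat.cast_le] at hsucc
    omega
  · rintro ⟨hT, hne⟩
    exact le_antisymm (hle T hT) (le_iInf₂ fun t ht =>
      Nat.cast_le.2 (not_lt.1 fun hlt => hne t hlt ht))

lemma episodeLength_congr (h : ∀ t : ℕ, t ≤ episodeLength M ω → (ω' t).1 = (ω t).1) :
    episodeLength M ω' = episodeLength M ω := by
  cases hT : episodeLength M ω with
  | top =>
    simp only [hT, le_top, forall_const] at h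
    simpa only [episodeLength, h] using hT
  | coe T =>
    simp only [hT, Nat.cast_le] at h
    rw [episodeLength_eq_iff] at hT ⊢
    exact ⟨(h T le_rfl).trans hT.1, fun t ht => h t ht.le ▸ hT.2 t ht⟩

open Classical in
/-- The trajectory `ω` with everything from the end of the episode on replaced by the constant
`(term, a₀)`. Trajectories with the same truncation are the same episode. -/
noncomputable def truncate (M : EpisodicMDP S A) (a₀ : A) (ω : Trajectory S A) :
    Trajectory S A :=
  fun t => if t < episodeLength M ω then ω t else (M.term, a₀)

lemma truncate_apply_of_lt {t : ℕ} (ht : t < episodeLength M ω) : truncate M a₀ ω t = ω t :=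
  if_pos ht

lemma truncate_apply_of_le {t : ℕ} (ht : episodeLength M ω ≤ t) :
    truncate M a₀ ω t = (M.term, a₀) :=
  if_neg ht.not_gt

lemma fst_truncate_apply {t : ℕ} (ht : t ≤ episodeLength M ω) :
    (truncate M a₀ ω t).1 = (ω t).1 := by
  rcases ht.lt_or_eq with hlt | heq
  · rw [truncate_apply_of_lt hlt]
  · rw [truncate_apply_of_le heq.ge, (episodeLength_eq_iff.1 heq.symm).1]

@[simp]
lemma episodeLength_truncate : episodeLength M (truncate M a₀ ω) = episodeLength M ω :=
  episodeLength_congr fun _ ht => fst_truncate_apply ht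

lemma truncate_truncate : truncate M a₀ (truncate M a₀ ω) = truncate M a₀ ω := by
  funext t
  rcases lt_or_ge (t : ℕ∞) (episodeLength M ω) with ht | ht
  · rw [truncate_apply_of_lt (by rwa [episodeLength_truncate])]
  · rw [truncate_apply_of_le (by rwa [episodeLength_truncate]), truncate_apply_of_le ht]

lemma lt_of_mem_range_toNat {n : ℕ∞} {t : ℕ} (ht : t ∈ Finset.range n.toNat) : t < n := by
  cases n with
  | top => simp at ht
  | coe n => simpa using ht

lemma cumReward_truncate : cumReward M (truncate M a₀ ω) = cumReward M ω := by
  unfold cumReward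
  rw [episodeLength_truncate]
  refine Finset.sum_congr rfl fun t ht => ?_
  have hlt := lt_of_mem_range_toNat ht
  rw [truncate_apply_of_lt hlt, fst_truncate_apply (by exact_mod_cast Order.add_one_le_of_lt hlt)]

lemma episodeScore_truncate (π : Policy d S A) (θ : Param d) :
    episodeScore M π θ (truncate M a₀ ω) = episodeScore M π θ ω := by
  unfold episodeScore
  rw [episodeLength_truncate]
  refine Finset.sum_congr rfl fun t ht => ?_
  rw [truncate_apply_of_lt (lt_of_mem_range_toNat ht)]

lemma truncate_eq_iff (hy : truncate M a₀ y = y) (hT : episodeLength M y = T) :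
    truncate M a₀ ω = y ↔ (∀ t < T, ω t = y t) ∧ (ω T).1 = (y T).1 := by
  constructor
  · rintro rfl
    rw [episodeLength_truncate] at hT
    exact ⟨fun t ht => (truncate_apply_of_lt (by simpa [hT] using ht)).symm,
      (fst_truncate_apply hT.ge).symm⟩
  · rintro ⟨hlt, hfst⟩
    have hlen : episodeLength M ω = T := hT ▸ episodeLength_congr fun t ht => by
      rw [hT, Nat.cast_le] at ht
      rcases ht.lt_or_eq with ht | rfl
      exacts [congrArg Prod.fst (hlt t ht), hfst]
    rw [← hy]
    funext t
    simp only [truncate, hlen, hT, Nat.cast_lt]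
    split_ifs with ht
    exacts [hlt t ht, rfl]

end Truncation

section EpisodeLaw

variable {S A : Type*} {d : ℕ} [Finite S] [Finite A] [MeasurableSpace S] [MeasurableSpace A]
  [MeasurableSingletonClass S] [MeasurableSingletonClass A]
  (M : EpisodicMDP S A) (π : Policy d S A) (θ : Param d) (a₀ : A) {y : Trajectory S A}

instance : IsProbabilityMeasure (episodeLaw M π θ) := by
  unfold episodeLaw trajLaw; infer_instance

/-- The factor of the probability of the path `y` up to time `n` which does not depend on the
policy: the probabilities of the start state and of the first `n` transitions. -/
noncomputable def transWeight {S A : Type*} (M : EpisodicMDP S A) (n : ℕ) (y : Trajectory S A) :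
    ℝ≥0∞ :=
  PMF.pure M.start (y 0).1 * ∏ t ∈ Finset.range n, M.trans (y t).1 (y t).2 (y (t + 1)).1

lemma episodeLaw_eval_zero_mem {B : Set (S × A)} (hB : MeasurableSet B) :
    episodeLaw M π θ {ω | ω 0 ∈ B} =
      ((PMF.pure M.start).bind (stateActionLaw π θ)).toMeasure B := by
  have hm : Measurable fun ω : Trajectory S A => ω 0 := measurable_pi_apply 0
  rw [PMF.pure_bind, ← map_eval_zero_trajMeasure (X := fun _ => S × A)
    (stateActionLaw π θ M.start).toMeasure (stepKernel M π θ), Measure.map_apply hm hB]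
  rfl

lemma episodeLaw_cylinder_inter_succ (n : ℕ) (y : Trajectory S A) {B : Set (S × A)}
    (hB : MeasurableSet B) :
    episodeLaw M π θ {ω | (∀ t ≤ n, ω t = y t) ∧ ω (n + 1) ∈ B} =
      episodeLaw M π θ {ω | ∀ t ≤ n, ω t = y t} *
        ((M.trans (y n).1 (y n).2).bind (stateActionLaw π θ)).toMeasure B :=
  trajMeasure_cylinder_inter_succ (X := fun _ => S × A) _ (stepKernel M π θ) n y hB

lemma episodeLaw_cylinder (n : ℕ) (y : Trajectory S A) :
    episodeLaw M π θ {ω | ∀ t ≤ n, ω t = y t} =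
      transWeight M n y * ∏ t ∈ Finset.range (n + 1), π θ (y t).1 (y t).2 := by
  induction n with
  | zero =>
    simp only [nonpos_iff_eq_zero, forall_eq]
    refine (episodeLaw_eval_zero_mem M π θ (measurableSet_singleton (y 0))).trans ?_
    rw [toMeasure_bind_stateActionLaw_singleton]
    simp [transWeight]
  | succ n ih =>
    have hset : {ω : Trajectory S A | ∀ t ≤ n + 1, ω t = y t} =
        {ω | (∀ t ≤ n, ω t = y t) ∧ ω (n + 1) ∈ ({y (n + 1)} : Set (S × A))} := by
      ext ω
      simp only [Set.mem_ofPred_eq, Set.mem_singleton_iff, Nat.le_succ_iff, or_imp, forall_and,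
        forall_eq]
    rw [hset, episodeLaw_cylinder_inter_succ M π θ n y (measurableSet_singleton _), ih,
      toMeasure_bind_stateActionLaw_singleton, transWeight, transWeight,
      Finset.prod_range_succ _ (n + 1),
      Finset.prod_range_succ (fun t => M.trans (y t).1 (y t).2 (y (t + 1)).1) n]
    ring

lemma episodeLaw_initialSegment (T : ℕ) (y : Trajectory S A) :
    episodeLaw M π θ {ω | (∀ t < T, ω t = y t) ∧ (ω T).1 = (y T).1} =
      transWeight M T y * ∏ t ∈ Finset.range T, π θ (y t).1 (y t).2 := by
  have hms : ∀ s : S, MeasurableSet {x : S × A | x.1 = s} := fun s => (Set.toFinite _).measurableSet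
  cases T with
  | zero =>
    simp only [not_lt_zero, IsEmpty.forall_iff, implies_true, true_and]
    refine (episodeLaw_eval_zero_mem M π θ (hms (y 0).1)).trans ?_
    rw [toMeasure_bind_stateActionLaw_fst_eq]
    simp [transWeight]
  | succ n =>
    simp only [Nat.lt_succ_iff]
    refine (episodeLaw_cylinder_inter_succ M π θ n y (hms (y (n + 1)).1)).trans ?_
    rw [episodeLaw_cylinder, toMeasure_bind_stateActionLaw_fst_eq, transWeight, transWeight,
      Finset.prod_range_succ (fun t => M.trans (y t).1 (y t).2 (y (t + 1)).1) n]
    ring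

end EpisodeLaw

section DistortionDeriv

/-- `k` is a `c'`-Lipschitz function on the line which is bounded by `c` on `[0,1]` and extends the
derivative of `g` from `(0,1)` as well as its right derivative at `0`. -/
structure IsDistortionDeriv (g k : ℝ → ℝ) (c : ℝ) (c' : ℝ≥0) : Prop where
  lipschitz : LipschitzWith c' k
  abs_le : ∀ t ∈ Set.Icc (0 : ℝ) 1, |k t| ≤ c
  hasDerivAt : ∀ t ∈ Set.Ioo (0 : ℝ) 1, HasDerivAt g (k t) t
  derivWithin_eq : ∀ t ∈ Set.Ico (0 : ℝ) 1, derivWithin g (Set.Icc 0 1) t = k t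

lemma derivWithin_Icc_eq_of_continuous {g k : ℝ → ℝ} {a b : ℝ} (hab : a < b)
    (hga : ContinuousWithinAt g (Set.Icc a b) a) (hk : Continuous k)
    (hg : ∀ t ∈ Set.Ioo a b, HasDerivAt g (k t) t) :
    ∀ t ∈ Set.Ico a b, derivWithin g (Set.Icc a b) t = k t := by
  intro t ht
  rcases ht.1.eq_or_lt with rfl | hat
  · have hlim : Filter.Tendsto (deriv g) (nhdsWithin a (Set.Ioi a)) (nhds (k a)) :=
      (hk.continuousWithinAt.tendsto).congr' <| by
        filter_upwards [Ioo_mem_nhdsGT hab] with x hx using (hg x hx).deriv.symm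
    have hderiv := hasDerivWithinAt_Ici_of_tendsto_deriv
      (fun t ht => (hg t ht).differentiableAt.differentiableWithinAt)
      (hga.mono Set.Ioo_subset_Icc_self) (Ioo_mem_nhdsGT hab) hlim
    exact (hderiv.mono Set.Icc_subset_Ici_self).derivWithin
      (uniqueDiffOn_Icc hab a (Set.left_mem_Icc.2 hab.le))
  · rw [derivWithin_of_mem_nhds (Icc_mem_nhds hat ht.2), (hg t ⟨hat, ht.2⟩).deriv]

lemma exists_isDistortionDeriv {g : ℝ → ℝ} {c : ℝ} {c' : ℝ≥0}
    (hg0 : ContinuousWithinAt g (Set.Icc 0 1) 0)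
    (hg1 : ∀ t ∈ Set.Ioo (0 : ℝ) 1, DifferentiableAt ℝ g t ∧ |deriv g t| ≤ c)
    (hg2 : ∀ t ∈ Set.Ioo (0 : ℝ) 1, DifferentiableAt ℝ (deriv g) t ∧ |deriv (deriv g) t| ≤ c') :
    ∃ k : ℝ → ℝ, IsDistortionDeriv g k c c' := by
  have hlip : LipschitzOnWith c' (deriv g) (Set.Ioo 0 1) :=
    (convex_Ioo 0 1).lipschitzOnWith_of_nnnorm_deriv_le (fun t ht => (hg2 t ht).1)
      fun t ht => (hg2 t ht).2
  obtain ⟨k, hk, hgk⟩ := hlip.extend_real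
  have hderiv : ∀ t ∈ Set.Ioo (0 : ℝ) 1, HasDerivAt g (k t) t := fun t ht =>
    hgk ht ▸ (hg1 t ht).1.hasDerivAt
  have habs : closure (Set.Ioo 0 1) ⊆ {t | |k t| ≤ c} :=
    closure_minimal (fun t ht => (congrArg abs (hgk ht)).symm.trans_le (hg1 t ht).2)
      (isClosed_le hk.continuous.abs continuous_const)
  rw [closure_Ioo (zero_ne_one' ℝ)] at habs
  exact ⟨k, hk, habs, hderiv,
    derivWithin_Icc_eq_of_continuous zero_lt_one hg0 hk.continuous hderiv⟩

end DistortionDeriv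

section Sampling

variable {H E : Type*}

/-- The empirical distribution of the sample `w`: the weight of `h` is its relative frequency. -/
noncomputable def empirical {m : ℕ} (w : Fin m → H) (h : H) : ℝ :=
  (m : ℝ)⁻¹ * ∑ i, Set.indicator {h} (fun _ => (1 : ℝ)) (w i)

lemma sum_empirical_smul [AddCommGroup E] [Module ℝ E] {m : ℕ} (w : Fin m → H) (v : H → E)
    (V : Finset H) :
    ∑ h ∈ V, empirical w h • v h = (m : ℝ)⁻¹ • ∑ i, Set.indicator (V : Set H) v (w i) := by
  classical
  simp_rw [empirical, mul_smul, ← Finset.smul_sum, Finset.sum_smul]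
  rw [Finset.sum_comm]
  simp [Set.indicator_apply]

variable [Fintype H]

lemma empirical_mem_stdSimplex {m : ℕ} (hm : 1 ≤ m) (w : Fin m → H) :
    empirical w ∈ stdSimplex ℝ H := by
  refine ⟨fun h => mul_nonneg (by positivity) (Finset.sum_nonneg fun i _ =>
    Set.indicator_nonneg (fun _ _ => zero_le_one) _), ?_⟩
  have hm0 : (m : ℝ) ≠ 0 := by positivity
  simpa [hm0] using sum_empirical_smul w (fun _ => (1 : ℝ)) Finset.univ

variable [NormedAddCommGroup E] [InnerProductSpace ℝ E] {q : H → ℝ}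

lemma sum_prod_mul_norm_sq_sum (hq : ∑ h, q h = 1) {Z : H → E} (hZ : ∑ h, q h • Z h = 0)
    (m : ℕ) :
    ∑ w : Fin m → H, (∏ i, q (w i)) * ‖∑ i, Z (w i)‖ ^ 2 = m * ∑ h, q h * ‖Z h‖ ^ 2 := by
  induction m with
  | zero => simp
  | succ m ih =>
    have hcross : ∀ v : E, ∑ h, q h * inner ℝ (Z h) v = 0 := fun v => by
      simp_rw [← real_inner_smul_left]
      rw [← sum_inner, hZ, inner_zero_left]
    have hfst : ∀ v : E, ∑ h, q h * ‖Z h + v‖ ^ 2 = ∑ h, q h * ‖Z h‖ ^ 2 + ‖v‖ ^ 2 := fun v => by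
      simp_rw [norm_add_sq_real, mul_add, Finset.sum_add_distrib, mul_left_comm (q _) 2,
        ← Finset.mul_sum, hcross, ← Finset.sum_mul, hq, mul_zero, add_zero, one_mul]
    have hone : ∑ w : Fin m → H, ∏ i, q (w i) = 1 := by rw [← Fintype.sum_pow, hq, one_pow]
    rw [← (Fin.consEquiv fun _ => H).sum_comp, Fintype.sum_prod_type, Finset.sum_comm]
    simp only [Fin.consEquiv_apply, Fin.prod_univ_succ, Fin.sum_univ_succ, Fin.cons_zero,
      Fin.cons_succ, mul_comm (q _) (Finset.prod _ _), mul_assoc]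
    simp_rw [← Finset.mul_sum, hfst, mul_add, Finset.sum_add_distrib]
    rw [ih, ← Finset.sum_mul, hone]
    push_cast
    ring

lemma sum_mul_norm_sub_sq_le (hq : q ∈ stdSimplex ℝ H) {Y : H → E} {b : ℝ}
    (hY : ∀ h, ‖Y h‖ ≤ b) : ∑ h, q h * ‖Y h - ∑ h, q h • Y h‖ ^ 2 ≤ b ^ 2 := by
  set μ := ∑ h, q h • Y h
  have hinner : ∑ h, q h * inner ℝ (Y h) μ = ‖μ‖ ^ 2 := by
    simp_rw [← real_inner_smul_left]
    rw [← sum_inner, real_inner_self_eq_norm_sq]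
  calc ∑ h, q h * ‖Y h - μ‖ ^ 2 = ∑ h, q h * ‖Y h‖ ^ 2 - ‖μ‖ ^ 2 := by
        simp_rw [norm_sub_sq_real, mul_add, mul_sub, Finset.sum_add_distrib,
          Finset.sum_sub_distrib, mul_left_comm (q _) 2, ← Finset.mul_sum, hinner,
          ← Finset.sum_mul, hq.2]
        ring
    _ ≤ ∑ h, q h * ‖Y h‖ ^ 2 := sub_le_self _ (sq_nonneg _)
    _ ≤ ∑ h, q h * b ^ 2 := by
        gcongr with h
        exacts [hq.1 h, hY h]
    _ = b ^ 2 := by rw [← Finset.sum_mul, hq.2, one_mul]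

lemma sum_prod_mul_norm_sq_sum_empirical_sub_le (hq : q ∈ stdSimplex ℝ H) {v : H → E} {b : ℝ}
    (hv : ∀ h, ‖v h‖ ≤ b) {m : ℕ} (hm : 1 ≤ m) (V : Finset H) :
    ∑ w : Fin m → H, (∏ i, q (w i)) *
      ‖∑ h ∈ V, empirical w h • v h - ∑ h ∈ V, q h • v h‖ ^ 2 ≤ b ^ 2 / m := by
  classical
  have hm0 : (m : ℝ) ≠ 0 := by positivity
  set Y := Set.indicator (V : Set H) v
  set μ := ∑ h, q h • Y h
  have hμ : ∑ h ∈ V, q h • v h = μ := by simp [μ, Y, Set.indicator_apply]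
  have hcentered : ∑ h, q h • (Y h - μ) = 0 := by
    simp_rw [smul_sub]
    rw [Finset.sum_sub_distrib, ← Finset.sum_smul, hq.2, one_smul, sub_self]
  have hmean : ∀ w : Fin m → H, ‖∑ h ∈ V, empirical w h • v h - ∑ h ∈ V, q h • v h‖ ^ 2 =
      ((m : ℝ)⁻¹) ^ 2 * ‖∑ i, (Y (w i) - μ)‖ ^ 2 := fun w => by
    have : ∑ h ∈ V, empirical w h • v h - ∑ h ∈ V, q h • v h =
        (m : ℝ)⁻¹ • ∑ i, (Y (w i) - μ) := by
      rw [sum_empirical_smul, hμ, Finset.sum_sub_distrib, smul_sub, Finset.sum_const,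
        Finset.card_univ, Fintype.card_fin, ← Nat.cast_smul_eq_nsmul ℝ, inv_smul_smul₀ hm0]
    rw [this, norm_smul, mul_pow, Real.norm_eq_abs, sq_abs]
  simp_rw [hmean, mul_left_comm _ (((m : ℝ)⁻¹) ^ 2), ← Finset.mul_sum]
  calc ((m : ℝ)⁻¹) ^ 2 * ∑ w : Fin m → H, (∏ i, q (w i)) * ‖∑ i, (Y (w i) - μ)‖ ^ 2
      = (∑ h, q h * ‖Y h - μ‖ ^ 2) / m := by
        rw [sum_prod_mul_norm_sq_sum hq.2 hcentered]
        field_simp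
    _ ≤ b ^ 2 / m := by
        gcongr
        exact sum_mul_norm_sub_sq_le hq fun h => (norm_indicator_le_norm_self v h).trans (hv h)

end Sampling

section Sublevel

variable {H E : Type*} [Fintype H] (X : H → ℝ)

open Classical in
/-- The set of outcomes at which the random variable `X` is at most `x`. -/
noncomputable def sublevel (x : ℝ) : Finset H := {h | X h ≤ x}

@[simp]
lemma mem_sublevel {x : ℝ} {h : H} : h ∈ sublevel X x ↔ X h ≤ x := by simp [sublevel]

/-- The length of the part of `(a, b]` on which the sublevel set of `X` is the event `V`. -/
noncomputable def sublevelLength (a b : ℝ) (V : Finset H) : ℝ :=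
  (volume.restrict (Set.Ioc a b)).real {x | sublevel X x = V}

lemma sublevelLength_nonneg (a b : ℝ) (V : Finset H) : 0 ≤ sublevelLength X a b V :=
  measureReal_nonneg

lemma measurableSet_setOf_sublevel_eq (V : Finset H) : MeasurableSet {x | sublevel X x = V} := by
  have hset : {x | sublevel X x = V} = ⋂ h, {x | X h ≤ x ↔ h ∈ V} := by
    ext x; simp [Finset.ext_iff]
  rw [hset]
  refine .iInter fun h => ?_
  by_cases hV : h ∈ V
  · simp only [hV, iff_true]
    exact measurableSet_Ici
  · simp only [hV, iff_false, not_le]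
    exact measurableSet_Iio

variable [NormedAddCommGroup E] (f : Finset H → E) {a b : ℝ}

lemma comp_sublevel_eq_sum_indicator :
    (fun x => f (sublevel X x)) =
      fun x => ∑ V, Set.indicator {x | sublevel X x = V} (fun _ => f V) x := by
  classical
  funext x
  simp [Set.indicator_apply]

lemma integrable_indicator_sublevel_eq (V : Finset H) :
    Integrable (Set.indicator {x | sublevel X x = V} fun _ => f V)
      (volume.restrict (Set.Ioc a b)) :=
  (integrable_const (f V)).indicator (measurableSet_setOf_sublevel_eq X V)

lemma intervalIntegrable_comp_sublevel (hab : a ≤ b) :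
    IntervalIntegrable (fun x => f (sublevel X x)) volume a b := by
  rw [intervalIntegrable_iff_integrableOn_Ioc_of_le hab, comp_sublevel_eq_sum_indicator]
  exact integrable_finsetSum _ fun V _ => integrable_indicator_sublevel_eq X f V

lemma intervalIntegral_comp_sublevel [NormedSpace ℝ E] [CompleteSpace E]
    (hab : a ≤ b) :
    ∫ x in a..b, f (sublevel X x) = ∑ V, sublevelLength X a b V • f V := by
  rw [intervalIntegral.integral_of_le hab, comp_sublevel_eq_sum_indicator,
    integral_finsetSum _ fun V _ => integrable_indicator_sublevel_eq X f V]
  exact Finset.sum_congr rfl fun V _ =>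
    integral_indicator_const _ (measurableSet_setOf_sublevel_eq X V)

lemma sum_sublevelLength (hab : a ≤ b) : ∑ V, sublevelLength X a b V = b - a := by
  simpa using (intervalIntegral_comp_sublevel X (fun _ => (1 : ℝ)) hab).symm

end Sublevel

section FiniteFamily

variable {E H : Type*} [Fintype H]

/-- The distortion risk measure, up to an additive constant, of a random variable on a finite space
with weights `q`: `len V` is the length of the part of the line on which the sublevel set of the
random variable is `V`. -/
noncomputable def finiteDRM (len : Finset H → ℝ) (g : ℝ → ℝ) (q : H → ℝ) : ℝ :=
  ∑ V, len V * g (1 - ∑ h ∈ V, q h)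

/-- The likelihood-ratio formula for the gradient of `finiteDRM` at the weights `q`, the
outcome `h` having the score `u h`; `k` stands for the derivative of the distortion function.
With empirical weights it is the estimate of the gradient from a sample. -/
noncomputable def finiteDRMGrad [AddCommGroup E] [Module ℝ E] (len : Finset H → ℝ) (k : ℝ → ℝ)
    (q : H → ℝ) (u : H → E) : E :=
  -∑ V, len V • k (1 - ∑ h ∈ V, q h) • ∑ h ∈ V, q h • u h

section Bounds

variable {q q' : H → ℝ} {V : Finset H} {len : Finset H → ℝ} {g k : ℝ → ℝ} {c B : ℝ} {c' : ℝ≥0}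

lemma one_sub_sum_mem_Icc (hq : q ∈ stdSimplex ℝ H) : 1 - ∑ h ∈ V, q h ∈ Set.Icc (0 : ℝ) 1 := by
  have hle := hq.2 ▸ Finset.sum_le_univ_sum_of_nonneg (s := V) hq.1
  exact ⟨sub_nonneg.2 hle, sub_le_self _ (Finset.sum_nonneg fun h _ => hq.1 h)⟩

lemma finiteDRM_mem_Icc (hlen : ∀ V, 0 ≤ len V)
    (hg : Set.MapsTo g (Set.Icc 0 1) (Set.Icc 0 1)) (hq : q ∈ stdSimplex ℝ H) :
    finiteDRM len g q ∈ Set.Icc 0 (∑ V, len V) := by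
  have hgV := fun V => hg (one_sub_sum_mem_Icc (V := V) hq)
  exact ⟨Finset.sum_nonneg fun V _ => mul_nonneg (hlen V) (hgV V).1,
    Finset.sum_le_sum fun V _ => mul_le_of_le_one_right (hlen V) (hgV V).2⟩

variable [NormedAddCommGroup E] [NormedSpace ℝ E] {u u' : H → E}

lemma norm_sum_smul_le_of_mem_stdSimplex (hq : q ∈ stdSimplex ℝ H) {v : H → E} {b : ℝ}
    (hv : ∀ h, ‖v h‖ ≤ b) : ‖∑ h ∈ V, q h • v h‖ ≤ b := by
  calc ‖∑ h ∈ V, q h • v h‖ ≤ ∑ h ∈ V, q h * ‖v h‖ :=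
        norm_sum_le_of_le _ fun h _ => by rw [norm_smul, Real.norm_of_nonneg (hq.1 h)]
    _ ≤ ∑ h, q h * ‖v h‖ :=
        Finset.sum_le_univ_sum_of_nonneg fun h => mul_nonneg (hq.1 h) (norm_nonneg _)
    _ ≤ ∑ h, q h * b := by
        gcongr with h
        exacts [hq.1 h, hv h]
    _ = b := by rw [← Finset.sum_mul, hq.2, one_mul]

lemma norm_finiteDRMGrad_le (hlen : ∀ V, 0 ≤ len V) (hk : IsDistortionDeriv g k c c')
    (hq : q ∈ stdSimplex ℝ H) (hu : ∀ h, ‖u h‖ ≤ B) :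
    ‖finiteDRMGrad len k q u‖ ≤ (∑ V, len V) * (c * B) := by
  rw [finiteDRMGrad, norm_neg, Finset.sum_mul]
  refine norm_sum_le_of_le _ fun V _ => ?_
  have hkc := hk.abs_le _ (one_sub_sum_mem_Icc (V := V) hq)
  rw [norm_smul, norm_smul, Real.norm_of_nonneg (hlen V), Real.norm_eq_abs]
  gcongr
  exacts [hlen V, (abs_nonneg _).trans hkc, norm_sum_smul_le_of_mem_stdSimplex hq hu]

lemma continuous_finiteDRMGrad {Θ : Type*} [TopologicalSpace Θ] {p : Θ → H → ℝ} {v : Θ → H → E}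
    (hk : IsDistortionDeriv g k c c') (hp : ∀ h, Continuous fun θ => p θ h)
    (hv : ∀ h, Continuous fun θ => v θ h) :
    Continuous fun θ => finiteDRMGrad len k (p θ) (v θ) := by
  have hkc := hk.lipschitz.continuous
  unfold finiteDRMGrad
  fun_prop

lemma norm_finiteDRMGrad_sub_le (hlen : ∀ V, 0 ≤ len V) (hk : IsDistortionDeriv g k c c')
    (hq : q ∈ stdSimplex ℝ H) (hq' : q' ∈ stdSimplex ℝ H) (hu' : ∀ h, ‖u' h‖ ≤ B) :
    ‖finiteDRMGrad len k q u - finiteDRMGrad len k q' u'‖ ≤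
      ∑ V, len V * (c * ‖∑ h ∈ V, q h • u h - ∑ h ∈ V, q' h • u' h‖ +
        c' * |∑ h ∈ V, q h - ∑ h ∈ V, q' h| * B) := by
  rw [finiteDRMGrad, finiteDRMGrad, ← neg_sub', norm_neg, ← Finset.sum_sub_distrib]
  refine norm_sum_le_of_le _ fun V _ => ?_
  rw [← smul_sub, norm_smul, Real.norm_of_nonneg (hlen V)]
  refine mul_le_mul_of_nonneg_left ?_ (hlen V)
  set a := 1 - ∑ h ∈ V, q h with ha
  set a' := 1 - ∑ h ∈ V, q' h with ha'
  have hkc : |k a| ≤ c := hk.abs_le _ (one_sub_sum_mem_Icc hq)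
  have hklip : |k a - k a'| ≤ c' * |∑ h ∈ V, q h - ∑ h ∈ V, q' h| := by
    have := hk.lipschitz.dist_le_mul a a'
    rwa [Real.dist_eq, Real.dist_eq, ha, ha', sub_sub_sub_cancel_left, abs_sub_comm (∑ h ∈ V, _)]
      at this
  have hsplit : k a • ∑ h ∈ V, q h • u h - k a' • ∑ h ∈ V, q' h • u' h =
      k a • (∑ h ∈ V, q h • u h - ∑ h ∈ V, q' h • u' h) +
        (k a - k a') • ∑ h ∈ V, q' h • u' h := by module
  rw [hsplit]
  refine (norm_add_le _ _).trans ?_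
  rw [norm_smul, norm_smul, Real.norm_eq_abs, Real.norm_eq_abs]
  gcongr
  exact norm_sum_smul_le_of_mem_stdSimplex hq' hu'

end Bounds

section MeanSquare

variable [NormedAddCommGroup E] [InnerProductSpace ℝ E] {q : H → ℝ} {u : H → E}
  {len : Finset H → ℝ} {g k : ℝ → ℝ} {c B : ℝ} {c' : ℝ≥0}

lemma sq_sum_mul_le_of_nonneg (hlen : ∀ V, 0 ≤ len V) (x : Finset H → ℝ) :
    (∑ V, len V * x V) ^ 2 ≤ (∑ V, len V) * ∑ V, len V * x V ^ 2 :=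
  Finset.sum_sq_le_sum_mul_sum_of_sq_le_mul _ (fun V _ => hlen V)
    (fun V _ => mul_nonneg (hlen V) (sq_nonneg _)) fun V _ => le_of_eq (by ring)

lemma norm_finiteDRMGrad_sub_sq_le {q' : H → ℝ} (hlen : ∀ V, 0 ≤ len V)
    (hk : IsDistortionDeriv g k c c') (hq : q ∈ stdSimplex ℝ H) (hq' : q' ∈ stdSimplex ℝ H)
    (hu : ∀ h, ‖u h‖ ≤ B) :
    ‖finiteDRMGrad len k q u - finiteDRMGrad len k q' u‖ ^ 2 ≤
      (∑ V, len V) * ∑ V, len V * (2 * (c ^ 2 * ‖∑ h ∈ V, q h • u h - ∑ h ∈ V, q' h • u h‖ ^ 2 +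
        c' ^ 2 * B ^ 2 * ‖∑ h ∈ V, q h • (1 : ℝ) - ∑ h ∈ V, q' h • (1 : ℝ)‖ ^ 2)) := by
  refine (pow_le_pow_left₀ (norm_nonneg _) (norm_finiteDRMGrad_sub_le hlen hk hq hq' hu) 2).trans
    ((sq_sum_mul_le_of_nonneg hlen _).trans ?_)
  gcongr with V
  · exact Finset.sum_nonneg fun V _ => hlen V
  · exact hlen V
  · refine add_sq_le.trans_eq ?_
    simp only [smul_eq_mul, mul_one, Real.norm_eq_abs]
    ring

lemma sum_prod_mul_norm_finiteDRMGrad_empirical_sub_sq_le (hlen : ∀ V, 0 ≤ len V)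
    (hk : IsDistortionDeriv g k c c') (hq : q ∈ stdSimplex ℝ H) (hu : ∀ h, ‖u h‖ ≤ B)
    {m : ℕ} (hm : 1 ≤ m) :
    ∑ w : Fin m → H, (∏ i, q (w i)) *
        ‖finiteDRMGrad len k (empirical w) u - finiteDRMGrad len k q u‖ ^ 2 ≤
      2 * (∑ V, len V) ^ 2 * B ^ 2 * (c ^ 2 + c' ^ 2) / m := by
  have hΛ : 0 ≤ ∑ V, len V := Finset.sum_nonneg fun V _ => hlen V
  let D (V : Finset H) (w : Fin m → H) := ‖∑ h ∈ V, empirical w h • u h - ∑ h ∈ V, q h • u h‖ ^ 2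
  let D' (V : Finset H) (w : Fin m → H) :=
    ‖∑ h ∈ V, empirical w h • (1 : ℝ) - ∑ h ∈ V, q h • (1 : ℝ)‖ ^ 2
  have hD : ∀ V, ∑ w, (∏ i, q (w i)) * D V w ≤ B ^ 2 / m := fun V =>
    sum_prod_mul_norm_sq_sum_empirical_sub_le hq hu hm V
  have hD' : ∀ V, ∑ w, (∏ i, q (w i)) * D' V w ≤ 1 ^ 2 / m := fun V =>
    sum_prod_mul_norm_sq_sum_empirical_sub_le hq (fun _ => norm_one.le) hm V
  calc _ ≤ ∑ w : Fin m → H, (∏ i, q (w i)) *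
        ((∑ V, len V) * ∑ V, len V * (2 * (c ^ 2 * D V w + c' ^ 2 * B ^ 2 * D' V w))) := by
        gcongr with w
        exacts [Finset.prod_nonneg fun i _ => hq.1 _,
          norm_finiteDRMGrad_sub_sq_le hlen hk (empirical_mem_stdSimplex hm w) hq hu]
    _ = (∑ V, len V) * ∑ V, len V * (2 * (c ^ 2 * ∑ w, (∏ i, q (w i)) * D V w +
          c' ^ 2 * B ^ 2 * ∑ w, (∏ i, q (w i)) * D' V w)) := by
        simp_rw [Finset.mul_sum, ← Finset.sum_add_distrib, Finset.mul_sum]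
        rw [Finset.sum_comm]
        exact Finset.sum_congr rfl fun V _ => Finset.sum_congr rfl fun w _ => by ring
    _ ≤ (∑ V, len V) * ∑ V, len V * (2 * (c ^ 2 * (B ^ 2 / m) + c' ^ 2 * B ^ 2 * (1 ^ 2 / m))) := by
        gcongr with V
        exacts [hlen V, hD V, hD' V]
    _ = 2 * (∑ V, len V) ^ 2 * B ^ 2 * (c ^ 2 + c' ^ 2) / m := by
        rw [← Finset.sum_mul]
        ring

end MeanSquare

variable [NormedAddCommGroup E] [InnerProductSpace ℝ E] [CompleteSpace E]

/-- A smoothly parameterized family of probability weights `p θ` with a common support, whose score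
functions `u θ = ∇ log p θ` are bounded by `B` and have derivatives in `θ` bounded by `C`. -/
structure HasBoundedScore (p : E → H → ℝ) (u : E → H → E) (B C : ℝ) : Prop where
  mem_stdSimplex : ∀ θ, p θ ∈ stdSimplex ℝ H
  eq_zero_of_eq_zero : ∀ θ θ' h, p θ h = 0 → p θ' h = 0
  hasGradientAt : ∀ θ h, HasGradientAt (fun ϑ => p ϑ h) (p θ h • u θ h) θ
  norm_score_le : ∀ θ h, ‖u θ h‖ ≤ B
  differentiable_score : ∀ h, Differentiable ℝ fun θ => u θ h
  norm_fderiv_score_le : ∀ θ h, ‖fderiv ℝ (fun ϑ => u ϑ h) θ‖ ≤ C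

namespace HasBoundedScore

variable {p : E → H → ℝ} {u : E → H → E} {B C : ℝ}

lemma mono (hp : HasBoundedScore p u B C) {B' C' : ℝ} (hB : B ≤ B') (hC : C ≤ C') :
    HasBoundedScore p u B' C' :=
  { hp with
    norm_score_le := fun θ h => (hp.norm_score_le θ h).trans hB
    norm_fderiv_score_le := fun θ h => (hp.norm_fderiv_score_le θ h).trans hC }

lemma nonneg (hp : HasBoundedScore p u B C) : 0 ≤ B ∧ 0 ≤ C := by
  obtain ⟨h, -, -⟩ := Finset.exists_ne_zero_of_sum_ne_zero
    ((hp.mem_stdSimplex 0).2.trans_ne one_ne_zero)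
  exact ⟨(norm_nonneg _).trans (hp.norm_score_le 0 h),
    (norm_nonneg _).trans (hp.norm_fderiv_score_le 0 h)⟩

lemma hasGradientAt_sum (hp : HasBoundedScore p u B C) (θ : E) (V : Finset H) :
    HasGradientAt (fun ϑ => ∑ h ∈ V, p ϑ h) (∑ h ∈ V, p θ h • u θ h) θ := by
  rw [hasGradientAt_iff_hasFDerivAt, map_sum]
  exact HasFDerivAt.fun_sum fun h _ => (hp.hasGradientAt θ h).hasFDerivAt

lemma sum_eq_zero_of_sum_eq_zero (hp : HasBoundedScore p u B C) {θ : E} {V : Finset H}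
    (h : ∑ h ∈ V, p θ h = 0) (θ' : E) : ∑ h ∈ V, p θ' h = 0 :=
  Finset.sum_eq_zero fun i hi => hp.eq_zero_of_eq_zero θ θ' i
    ((Finset.sum_eq_zero_iff_of_nonneg fun i _ => (hp.mem_stdSimplex θ).1 i).1 h i hi)

lemma one_sub_sum_mem_Ioo_or_sum_eq (hp : HasBoundedScore p u B C) (θ : E) (V : Finset H) :
    1 - ∑ h ∈ V, p θ h ∈ Set.Ioo (0 : ℝ) 1 ∨ ∀ θ', ∑ h ∈ V, p θ' h = ∑ h ∈ V, p θ h := by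
  classical
  have hcompl : ∀ θ, ∑ h ∈ Vᶜ, p θ h = 1 - ∑ h ∈ V, p θ h := fun θ => by
    rw [← (hp.mem_stdSimplex θ).2, ← Finset.sum_compl_add_sum V, add_sub_cancel_right]
  obtain ⟨h0, h1⟩ := one_sub_sum_mem_Icc (V := V) (hp.mem_stdSimplex θ)
  rcases h0.eq_or_lt with h0 | h0
  · refine .inr fun θ' => ?_
    have := hp.sum_eq_zero_of_sum_eq_zero ((hcompl θ).trans h0.symm) θ'
    linarith [hcompl θ']
  rcases h1.eq_or_lt with h1 | h1
  · have hV : ∑ h ∈ V, p θ h = 0 := by linarith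
    exact .inr fun θ' => (hp.sum_eq_zero_of_sum_eq_zero hV θ').trans hV.symm
  · exact .inl ⟨h0, h1⟩

lemma continuous_weight (hp : HasBoundedScore p u B C) (h : H) : Continuous fun θ => p θ h :=
  continuous_iff_continuousAt.2 fun θ => (hp.hasGradientAt θ h).continuousAt

lemma continuous_score (hp : HasBoundedScore p u B C) (h : H) : Continuous fun θ => u θ h :=
  (hp.differentiable_score h).continuous

variable {len : Finset H → ℝ} {g k : ℝ → ℝ} {c : ℝ} {c' : ℝ≥0}

lemma hasGradientAt_comp_one_sub_sum (hp : HasBoundedScore p u B C)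
    (hk : IsDistortionDeriv g k c c') (θ : E) (V : Finset H) :
    HasGradientAt (fun ϑ => g (1 - ∑ h ∈ V, p ϑ h))
      (-(k (1 - ∑ h ∈ V, p θ h) • ∑ h ∈ V, p θ h • u θ h)) θ := by
  have hsum := hp.hasGradientAt_sum θ V
  rcases hp.one_sub_sum_mem_Ioo_or_sum_eq θ V with hmem | hconst
  · have hcomp := (hk.hasDerivAt _ hmem).comp_hasFDerivAt θ (hsum.hasFDerivAt.const_sub 1)
    rw [hasGradientAt_iff_hasFDerivAt]
    refine hcomp.congr_fderiv ?_
    rw [map_neg, map_smul, smul_neg]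
  · have hzero : ∑ h ∈ V, p θ h • u θ h = 0 := by
      refine hsum.unique ?_
      simp_rw [hconst]
      exact hasGradientAt_const _ _
    simp only [hzero, hconst, smul_zero, neg_zero]
    exact hasGradientAt_const _ _

lemma hasGradientAt_finiteDRM (hp : HasBoundedScore p u B C) (hk : IsDistortionDeriv g k c c')
    (len : Finset H → ℝ) (θ : E) :
    HasGradientAt (fun ϑ => finiteDRM len g (p ϑ)) (finiteDRMGrad len k (p θ) (u θ)) θ := by
  rw [hasGradientAt_iff_hasFDerivAt]
  refine (HasFDerivAt.fun_sum fun V _ =>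
    (hp.hasGradientAt_comp_one_sub_sum hk θ V).hasFDerivAt.const_mul (len V)).congr_fderiv ?_
  simp only [finiteDRMGrad, map_neg, map_sum, map_smulₛₗ, smul_neg, Finset.sum_neg_distrib,
    conj_trivial]

lemma abs_sum_sub_sum_le (hp : HasBoundedScore p u B C) (θ θ' : E) (V : Finset H) :
    |∑ h ∈ V, p θ h - ∑ h ∈ V, p θ' h| ≤ B * ‖θ - θ'‖ := by
  refine convex_univ.norm_image_sub_le_of_norm_hasFDerivWithin_le
    (f := fun ϑ => ∑ h ∈ V, p ϑ h)
    (fun x _ => (hp.hasGradientAt_sum x V).hasFDerivAt.hasFDerivWithinAt) (fun x _ => ?_)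
    (Set.mem_univ θ') (Set.mem_univ θ)
  rw [LinearIsometryEquiv.norm_map]
  exact norm_sum_smul_le_of_mem_stdSimplex (hp.mem_stdSimplex x) (hp.norm_score_le x)

lemma norm_sum_smul_score_sub_le (hp : HasBoundedScore p u B C) (θ θ' : E) (V : Finset H) :
    ‖∑ h ∈ V, p θ h • u θ h - ∑ h ∈ V, p θ' h • u θ' h‖ ≤ (B ^ 2 + C) * ‖θ - θ'‖ := by
  let D : E → H → E →L[ℝ] E := fun x h =>
    (InnerProductSpace.toDual ℝ E (u x h)).smulRight (u x h) + fderiv ℝ (fun ϑ => u ϑ h) x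
  have hD : ∀ x, HasFDerivAt (fun ϑ => ∑ h ∈ V, p ϑ h • u ϑ h) (∑ h ∈ V, p x h • D x h) x := by
    refine fun x => HasFDerivAt.fun_sum fun h _ => ((hp.hasGradientAt x h).hasFDerivAt.smul
      (hp.differentiable_score h x).hasFDerivAt).congr_fderiv ?_
    ext v
    simp [D, smul_smul, add_comm]
  have hnorm : ∀ x h, ‖D x h‖ ≤ B ^ 2 + C := fun x h => by
    refine (norm_add_le _ _).trans (add_le_add ?_ (hp.norm_fderiv_score_le x h))
    rw [ContinuousLinearMap.norm_smulRight_apply, LinearIsometryEquiv.norm_map, ← sq]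
    exact pow_le_pow_left₀ (norm_nonneg _) (hp.norm_score_le x h) 2
  exact convex_univ.norm_image_sub_le_of_norm_hasFDerivWithin_le
    (f := fun ϑ => ∑ h ∈ V, p ϑ h • u ϑ h) (fun x _ => (hD x).hasFDerivWithinAt)
    (fun x _ => norm_sum_smul_le_of_mem_stdSimplex (hp.mem_stdSimplex x) (hnorm x))
    (Set.mem_univ θ') (Set.mem_univ θ)

lemma norm_finiteDRMGrad_sub_le_mul (hp : HasBoundedScore p u B C) (hlen : ∀ V, 0 ≤ len V)
    (hk : IsDistortionDeriv g k c c') (θ θ' : E) :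
    ‖finiteDRMGrad len k (p θ) (u θ) - finiteDRMGrad len k (p θ') (u θ')‖ ≤
      (∑ V, len V) * (c * (B ^ 2 + C) + c' * B ^ 2) * ‖θ - θ'‖ := by
  have hc : 0 ≤ c := (abs_nonneg _).trans (hk.abs_le 0 (Set.left_mem_Icc.2 zero_le_one))
  have hB := hp.nonneg.1
  calc _ ≤ ∑ V, len V * (c * ((B ^ 2 + C) * ‖θ - θ'‖) + c' * (B * ‖θ - θ'‖) * B) := by
        refine (norm_finiteDRMGrad_sub_le hlen hk (hp.mem_stdSimplex θ) (hp.mem_stdSimplex θ')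
          (hp.norm_score_le θ')).trans ?_
        gcongr with V
        exacts [hlen V, hp.norm_sum_smul_score_sub_le θ θ' V, hp.abs_sum_sub_sum_le θ θ' V]
    _ = _ := by
        rw [← Finset.sum_mul]
        ring

end HasBoundedScore

end FiniteFamily

section Episodes

variable {S A : Type*} {d : ℕ} (M : EpisodicMDP S A) (a₀ : A) (n : ℕ)

/-- The trajectories of length at most `n` which are equal to their own truncation. They represent
the episodes of length at most `n`. -/
def episodes : Set (Trajectory S A) := {y | truncate M a₀ y = y ∧ episodeLength M y ≤ n}

variable {M a₀ n} {ω : Trajectory S A}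

lemma truncate_mem_episodes (hω : episodeLength M ω ≤ n) : truncate M a₀ ω ∈ episodes M a₀ n :=
  ⟨truncate_truncate, episodeLength_truncate.trans_le hω⟩

lemma coe_toNat_episodeLength (y : episodes M a₀ n) :
    ((episodeLength M y).toNat : ℕ∞) = episodeLength M y :=
  ENat.natCast_toNat (ne_top_of_le_ne_top (ENat.natCast_ne_top n) y.2.2)

lemma toNat_episodeLength_le (y : episodes M a₀ n) : (episodeLength M y).toNat ≤ n :=
  ENat.toNat_le_of_le_natCast y.2.2

lemma truncate_eq_coe_iff (y : episodes M a₀ n) :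
    truncate M a₀ ω = y ↔ (∀ t < (episodeLength M y).toNat, ω t = y.1 t) ∧
      (ω (episodeLength M y).toNat).1 = (y.1 (episodeLength M y).toNat).1 :=
  truncate_eq_iff y.2.1 (coe_toNat_episodeLength y).symm

lemma norm_sum_range_toNat_episodeLength_le {F : Type*} [SeminormedAddCommGroup F]
    (y : episodes M a₀ n) {v : ℕ → F} {b : ℝ} (hv : ∀ t, ‖v t‖ ≤ b) :
    ‖∑ t ∈ Finset.range (episodeLength M y).toNat, v t‖ ≤ n * b := by
  have hb : 0 ≤ b := (norm_nonneg _).trans (hv 0)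
  calc _ ≤ ∑ _t ∈ Finset.range (episodeLength M y).toNat, b := norm_sum_le_of_le _ fun t _ => hv t
    _ = (episodeLength M y).toNat * b := by
        rw [Finset.sum_const, Finset.card_range, nsmul_eq_mul]
    _ ≤ n * b := by
        gcongr
        exact toNat_episodeLength_le y

instance [Finite S] [Finite A] : Finite (episodes M a₀ n) := by
  refine Finite.of_injective (fun (y : episodes M a₀ n) (t : Fin n) => y.1 t) fun y y' h => ?_
  refine Subtype.ext (funext fun t => ?_)
  rcases lt_or_ge t n with ht | ht
  · exact congrFun h ⟨t, ht⟩
  · have hterm : ∀ z : episodes M a₀ n, z.1 t = (M.term, a₀) := fun z => by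
      rw [← z.2.1, truncate_apply_of_le (z.2.2.trans (Nat.cast_le.2 ht))]
    rw [hterm y, hterm y']

noncomputable instance [Finite S] [Finite A] : Fintype (episodes M a₀ n) := Fintype.ofFinite _

variable [MeasurableSpace S] [MeasurableSpace A] [MeasurableSingletonClass S]
  [MeasurableSingletonClass A]

lemma measurableSet_truncate_eq_coe (y : episodes M a₀ n) :
    MeasurableSet {ω | truncate M a₀ ω = y} := by
  simp only [truncate_eq_coe_iff, Set.ofPred_and, Set.ofPred_forall]
  refine .inter ?_ ((measurable_pi_apply _).fst (measurableSet_singleton _))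
  exact .iInter fun t => .iInter fun _ => measurable_pi_apply t (measurableSet_singleton _)

variable [Finite S] [Finite A] (π : Policy d S A)

/-- The probability of the episode `y` under the policy `π_θ`. -/
noncomputable def episodeProb (θ : Param d) (y : episodes M a₀ n) : ℝ :=
  (episodeLaw M π θ).real {ω | truncate M a₀ ω = y}

lemma sum_episodeProb (θ : Param d) (V : Finset (episodes M a₀ n)) :
    ∑ y ∈ V, episodeProb π θ y = (episodeLaw M π θ).real {ω | ∃ y ∈ V, truncate M a₀ ω = y} := by
  have hset : {ω | ∃ y ∈ V, truncate M a₀ ω = y} = ⋃ y ∈ V, {ω | truncate M a₀ ω = y} := by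
    ext ω
    simp
  rw [hset, measureReal_biUnion_finset _ fun y _ => measurableSet_truncate_eq_coe y]
  · rfl
  · exact fun y _ y' _ hne => Set.disjoint_left.2 fun ω h h' => hne (Subtype.ext (h.symm.trans h'))

variable {π}

lemma episodeProb_eq (hpos : ∀ θ s a, π θ s a ≠ 0) (θ : Param d) (y : episodes M a₀ n) :
    episodeProb π θ y = (transWeight M (episodeLength M y).toNat y).toReal *
      Real.exp (∑ t ∈ Finset.range (episodeLength M y).toNat,
        logPolicy π (y.1 t).1 (y.1 t).2 θ) := by
  have hexp : ∀ s a, Real.exp (logPolicy π s a θ) = (π θ s a).toReal := fun s a =>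
    Real.exp_log (ENNReal.toReal_pos (hpos θ s a) (PMF.apply_ne_top _ _))
  simp only [episodeProb, truncate_eq_coe_iff, measureReal_def, Real.exp_sum, hexp]
  rw [episodeLaw_initialSegment, ENNReal.toReal_mul, ENNReal.toReal_prod]

lemma hasGradientAt_const_mul_exp_sum {E ι : Type*} [NormedAddCommGroup E] [InnerProductSpace ℝ E]
    [CompleteSpace E] (c : ℝ) (s : Finset ι) {f : ι → E → ℝ} {x : E}
    (hf : ∀ i ∈ s, DifferentiableAt ℝ (f i) x) :
    HasGradientAt (fun y => c * Real.exp (∑ i ∈ s, f i y))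
      ((c * Real.exp (∑ i ∈ s, f i x)) • ∑ i ∈ s, gradient (f i) x) x := by
  have hsum : HasFDerivAt (fun y => ∑ i ∈ s, f i y)
      (∑ i ∈ s, InnerProductSpace.toDual ℝ E (gradient (f i) x)) x :=
    HasFDerivAt.fun_sum fun i hi => (hf i hi).hasGradientAt.hasFDerivAt
  rw [hasGradientAt_iff_hasFDerivAt]
  refine (hsum.exp.const_mul c).congr_fderiv ?_
  rw [map_smulₛₗ, map_sum, smul_smul]
  rfl

lemma hasBoundedScore_episodeProb {B C : ℝ} (a₀ : A)
    (hlength : ∀ θ, ∀ᵐ ω ∂episodeLaw M π θ, episodeLength M ω ≤ n)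
    (hpos : ∀ θ s a, π θ s a ≠ 0) (hdiff : ∀ s a, Differentiable ℝ (logPolicy π s a))
    (hdiff2 : ∀ s a, Differentiable ℝ (gradient (logPolicy π s a)))
    (hscore : ∀ θ s a, ‖gradient (logPolicy π s a) θ‖ ≤ B)
    (hhess : ∀ θ s a, ‖fderiv ℝ (gradient (logPolicy π s a)) θ‖ ≤ C) :
    HasBoundedScore (episodeProb (M := M) (a₀ := a₀) (n := n) π)
      (fun θ y => episodeScore M π θ y) (n * B) (n * C) where
  mem_stdSimplex θ := by
    refine ⟨fun y => measureReal_nonneg, ?_⟩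
    rw [sum_episodeProb, ← probReal_univ (μ := episodeLaw M π θ)]
    refine measureReal_congr (Filter.eventuallyEq_univ.2 ?_)
    filter_upwards [hlength θ] with ω hω
    exact ⟨⟨_, truncate_mem_episodes hω⟩, Finset.mem_univ _, rfl⟩
  eq_zero_of_eq_zero θ θ' y h := by
    rw [episodeProb_eq hpos] at h ⊢
    rw [(mul_eq_zero_iff_right (Real.exp_ne_zero _)).1 h, zero_mul]
  hasGradientAt θ y := by
    simp only [episodeProb_eq hpos, episodeScore]
    exact hasGradientAt_const_mul_exp_sum _ _ fun t _ => hdiff _ _ θ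
  norm_score_le θ y := norm_sum_range_toNat_episodeLength_le y fun t => hscore θ _ _
  differentiable_score y := Differentiable.fun_sum fun t _ => hdiff2 _ _
  norm_fderiv_score_le θ y := by
    simp only [episodeScore]
    rw [fderiv_fun_sum fun t _ => hdiff2 _ _ θ]
    exact norm_sum_range_toNat_episodeLength_le y fun t => hhess θ _ _

end Episodes

section FiniteReduction

variable {S A : Type*} {d : ℕ} {M : EpisodicMDP S A} {a₀ : A} {n : ℕ}

lemma EpisodicMDP.rewardBound_nonneg (M : EpisodicMDP S A) : 0 ≤ M.rewardBound :=
  div_nonneg M.rMax_pos.le (sub_nonneg.2 M.γ_lt_one.le)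

variable [Finite S] [Finite A]

variable (M a₀ n) in
/-- The length of the part of `(-M_r, M_r]` on which the episodes with cumulative reward at
most `x` are those in `V`. -/
noncomputable def rewardLength : Finset (episodes M a₀ n) → ℝ :=
  sublevelLength (fun y => cumReward M y) (-M.rewardBound) M.rewardBound

lemma rewardLength_nonneg (V : Finset (episodes M a₀ n)) : 0 ≤ rewardLength M a₀ n V :=
  sublevelLength_nonneg _ _ _ V

lemma sum_rewardLength : ∑ V, rewardLength M a₀ n V = 2 * M.rewardBound := by
  rw [rewardLength, sum_sublevelLength _ (neg_le_self M.rewardBound_nonneg)]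
  ring

variable {π : Policy d S A} {g k : ℝ → ℝ} {c : ℝ} {c' : ℝ≥0} {θ : Param d} {m : ℕ}

lemma inv_smul_sum_indicator_cumReward_le {E : Type*} [AddCommGroup E] [Module ℝ E]
    {y : Fin m → episodes M a₀ n} {w : Fin m → Trajectory S A}
    (hw : ∀ i, truncate M a₀ (w i) = y i) {v : Trajectory S A → E}
    (hv : ∀ ω, v (truncate M a₀ ω) = v ω) (x : ℝ) :
    (m : ℝ)⁻¹ • ∑ i, Set.indicator {ω | cumReward M ω ≤ x} v (w i) =
      ∑ h ∈ sublevel (fun y : episodes M a₀ n => cumReward M y) x, empirical y h • v h := by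
  classical
  rw [sum_empirical_smul]
  congr 1
  refine Finset.sum_congr rfl fun i _ => ?_
  simp only [Set.indicator_apply, Set.mem_ofPred_eq, Finset.mem_coe, mem_sublevel, ← hw i, hv,
    cumReward_truncate]

lemma derivWithin_smul_sum_eq {E H : Type*} [Fintype H] [AddCommGroup E] [Module ℝ E]
    (hk : IsDistortionDeriv g k c c') {q : H → ℝ} (hq : q ∈ stdSimplex ℝ H) (V : Finset H)
    (u : H → E) :
    derivWithin g (Set.Icc 0 1) (1 - ∑ h ∈ V, q h) • ∑ h ∈ V, q h • u h =
      k (1 - ∑ h ∈ V, q h) • ∑ h ∈ V, q h • u h := by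
  obtain ⟨h0, h1⟩ := one_sub_sum_mem_Icc (V := V) hq
  rcases h1.lt_or_eq with h1 | h1
  · rw [hk.derivWithin_eq _ ⟨h0, h1⟩]
  · have hzero := (Finset.sum_eq_zero_iff_of_nonneg fun h _ => hq.1 h).1 (sub_eq_self.1 h1)
    have hsum : ∑ h ∈ V, q h • u h = 0 := Finset.sum_eq_zero fun h hh => by
      rw [hzero h hh, zero_smul]
    rw [hsum, smul_zero, smul_zero]

lemma gradEstimate_eq_finiteDRMGrad (hk : IsDistortionDeriv g k c c') (hm : 1 ≤ m)
    {y : Fin m → episodes M a₀ n} {w : Fin m → Trajectory S A}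
    (hw : ∀ i, truncate M a₀ (w i) = y i) :
    gradEstimate M π g θ w =
      finiteDRMGrad (rewardLength M a₀ n) k (empirical y) (fun h => episodeScore M π θ h) := by
  have hcdf : ∀ x, empCDF M w x =
      ∑ h ∈ sublevel (fun y : episodes M a₀ n => cumReward M y) x, empirical y h := fun x => by
    simpa only [empCDF, smul_eq_mul, mul_one] using
      inv_smul_sum_indicator_cumReward_le hw (v := fun _ => (1 : ℝ)) (fun _ => rfl) x
  have hgrad : ∀ x, gradEmpCDF M π θ w x =
      ∑ h ∈ sublevel (fun y : episodes M a₀ n => cumReward M y) x,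
        empirical y h • episodeScore M π θ h :=
    inv_smul_sum_indicator_cumReward_le hw fun _ => episodeScore_truncate π θ
  simp_rw [gradEstimate, finiteDRMGrad, hcdf, hgrad,
    derivWithin_smul_sum_eq hk (empirical_mem_stdSimplex hm y)]
  rw [intervalIntegral_comp_sublevel _
    (fun V => k (1 - ∑ h ∈ V, empirical y h) • ∑ h ∈ V, empirical y h • episodeScore M π θ h)
    (neg_le_self M.rewardBound_nonneg)]
  rfl

variable [MeasurableSpace S] [MeasurableSpace A]
  [MeasurableSingletonClass S] [MeasurableSingletonClass A]

lemma rewardCDF_eq_sum_episodeProb (a₀ : A)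
    (hlength : ∀ᵐ ω ∂episodeLaw M π θ, episodeLength M ω ≤ n) (x : ℝ) :
    rewardCDF M π θ x =
      ∑ y ∈ sublevel (fun y : episodes M a₀ n => cumReward M y) x, episodeProb π θ y := by
  rw [rewardCDF, sum_episodeProb]
  refine measureReal_congr (Filter.eventuallyEq_set.2 ?_)
  filter_upwards [hlength] with ω hω
  constructor
  · intro hx
    exact ⟨⟨_, truncate_mem_episodes hω⟩, (mem_sublevel _).2 (cumReward_truncate.trans_le hx), rfl⟩
  · rintro ⟨y, hy, hωy⟩
    rw [mem_sublevel, ← hωy, cumReward_truncate] at hy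
    exact hy

lemma drm_eq_finiteDRM_sub (a₀ : A) (hlength : ∀ᵐ ω ∂episodeLaw M π θ, episodeLength M ω ≤ n) :
    drm M π g θ = finiteDRM (rewardLength M a₀ n) g (episodeProb π θ) - M.rewardBound := by
  let f (V : Finset (episodes M a₀ n)) := g (1 - ∑ y ∈ V, episodeProb π θ y)
  have hneg := neg_nonpos.2 M.rewardBound_nonneg
  have hint := intervalIntegrable_comp_sublevel
    (fun y : episodes M a₀ n => cumReward M y) f hneg
  simp_rw [drm, rewardCDF_eq_sum_episodeProb a₀ hlength]
  rw [intervalIntegral.integral_sub hint intervalIntegrable_const, intervalIntegral.integral_const,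
    sub_add_eq_add_sub, intervalIntegral.integral_add_adjacent_intervals hint
      (intervalIntegrable_comp_sublevel _ f M.rewardBound_nonneg),
    intervalIntegral_comp_sublevel _ f (neg_le_self M.rewardBound_nonneg)]
  simp [finiteDRM, rewardLength, f]

end FiniteReduction

section Smoothness

variable {S A : Type*} {d : ℕ} [Finite S] [Finite A] [MeasurableSpace S] [MeasurableSpace A]
  [MeasurableSingletonClass S] [MeasurableSingletonClass A]

/-- The likelihood-ratio expression `-∫ k(1 - F(x)) ∇F(x) dx` of the gradient of the distortion
risk measure, as a finite sum over sets of episodes of length at most `n`; `k` stands for `g'`. -/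
noncomputable def drmGrad (M : EpisodicMDP S A) (π : Policy d S A) (a₀ : A) (n : ℕ) (k : ℝ → ℝ)
    (θ : Param d) : Param d :=
  finiteDRMGrad (rewardLength M a₀ n) k (episodeProb π θ) fun y => episodeScore M π θ y

variable {M : EpisodicMDP S A} {π : Policy d S A} {a₀ : A} {n : ℕ} {g k : ℝ → ℝ} {B C c : ℝ}
  {c' : ℝ≥0}

lemma hasBoundedScore_episodeProb_of_ae_le {Me Md Mh : ℝ} (a₀ : A)
    (hlength : ∀ θ, ∀ᵐ ω ∂episodeLaw M π θ, ∃ n : ℕ, episodeLength M ω = n ∧ (n : ℝ) ≤ Me)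
    (hpos : ∀ θ s a, π θ s a ≠ 0) (hdiff : ∀ s a, Differentiable ℝ (logPolicy π s a))
    (hdiff2 : ∀ s a, Differentiable ℝ (gradient (logPolicy π s a)))
    (hscore : ∀ θ s a, ‖gradient (logPolicy π s a) θ‖ ≤ Md)
    (hhess : ∀ θ s a, ‖fderiv ℝ (gradient (logPolicy π s a)) θ‖ ≤ Mh) :
    ∃ n : ℕ, (∀ θ, ∀ᵐ ω ∂episodeLaw M π θ, episodeLength M ω ≤ n) ∧
      HasBoundedScore (episodeProb (M := M) (a₀ := a₀) (n := n) π)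
        (fun θ y => episodeScore M π θ y) (Me * Md) (Me * Mh) := by
  have hfloor : ∀ θ, ∀ᵐ ω ∂episodeLaw M π θ, episodeLength M ω ≤ ⌊Me⌋₊ := fun θ => by
    filter_upwards [hlength θ] with ω ⟨n, hn, hle⟩
    exact hn.trans_le (Nat.cast_le.2 (Nat.le_floor hle))
  have hMe : (⌊Me⌋₊ : ℝ) ≤ Me := by
    obtain ⟨ω, n, -, hle⟩ := (hlength 0).exists
    exact Nat.floor_le (n.cast_nonneg.trans hle)
  exact ⟨⌊Me⌋₊, hfloor,
    (hasBoundedScore_episodeProb a₀ hfloor hpos hdiff hdiff2 hscore hhess).mono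
      (mul_le_mul_of_nonneg_right hMe ((norm_nonneg _).trans (hscore 0 M.start a₀)))
      (mul_le_mul_of_nonneg_right hMe ((norm_nonneg _).trans (hhess 0 M.start a₀)))⟩

variable (hp : HasBoundedScore (episodeProb (M := M) (a₀ := a₀) (n := n) π)
  (fun θ y => episodeScore M π θ y) B C)
include hp

lemma drm_mem_Icc (hlength : ∀ θ, ∀ᵐ ω ∂episodeLaw M π θ, episodeLength M ω ≤ n)
    (hg : Set.MapsTo g (Set.Icc 0 1) (Set.Icc 0 1)) (θ : Param d) :
    drm M π g θ ∈ Set.Icc (-M.rewardBound) M.rewardBound := by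
  have h := finiteDRM_mem_Icc (len := rewardLength M a₀ n) rewardLength_nonneg hg
    (hp.mem_stdSimplex θ)
  rw [sum_rewardLength] at h
  rw [drm_eq_finiteDRM_sub a₀ (hlength θ)]
  exact ⟨by linarith [h.1], by linarith [h.2]⟩

lemma bddAbove_range_drm (hlength : ∀ θ, ∀ᵐ ω ∂episodeLaw M π θ, episodeLength M ω ≤ n)
    (hg : Set.MapsTo g (Set.Icc 0 1) (Set.Icc 0 1)) : BddAbove (Set.range (drm M π g)) :=
  ⟨M.rewardBound, Set.forall_mem_range.2 fun θ => (drm_mem_Icc hp hlength hg θ).2⟩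

lemma hasGradientAt_drm (hlength : ∀ θ, ∀ᵐ ω ∂episodeLaw M π θ, episodeLength M ω ≤ n)
    (hk : IsDistortionDeriv g k c c') (θ : Param d) :
    HasGradientAt (drm M π g) (drmGrad M π a₀ n k θ) θ := by
  have hdrm : drm M π g = fun ϑ =>
      finiteDRM (rewardLength M a₀ n) g (episodeProb π ϑ) - M.rewardBound :=
    funext fun ϑ => drm_eq_finiteDRM_sub a₀ (hlength ϑ)
  rw [hdrm, hasGradientAt_iff_hasFDerivAt]
  exact (hp.hasGradientAt_finiteDRM hk _ θ).hasFDerivAt.sub_const _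

lemma norm_drmGrad_le (hk : IsDistortionDeriv g k c c') (θ : Param d) :
    ‖drmGrad M π a₀ n k θ‖ ≤ 2 * M.rewardBound * (c * B) := by
  rw [← sum_rewardLength (a₀ := a₀) (n := n)]
  exact norm_finiteDRMGrad_le rewardLength_nonneg hk (hp.mem_stdSimplex θ) (hp.norm_score_le θ)

lemma lipschitzWith_drmGrad (hk : IsDistortionDeriv g k c c') :
    LipschitzWith (2 * M.rewardBound * (c * (B ^ 2 + C) + c' * B ^ 2)).toNNReal
      (drmGrad M π a₀ n k) := by
  refine .of_dist_le' fun θ θ' => ?_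
  rw [← sum_rewardLength (a₀ := a₀) (n := n), dist_eq_norm, dist_eq_norm]
  exact hp.norm_finiteDRMGrad_sub_le_mul rewardLength_nonneg hk θ θ'

end Smoothness

section Batch

variable {S A : Type*} {d : ℕ} {M : EpisodicMDP S A} {a₀ : A} {n m : ℕ}

variable (M) in
/-- The batches whose `i`-th episode is `y i`. -/
def batchEvent (y : Fin m → episodes M a₀ n) : Set (Fin m → Trajectory S A) :=
  {w | ∀ i, truncate M a₀ (w i) = y i}

lemma batchEvent_eq_pi (y : Fin m → episodes M a₀ n) :
    batchEvent M y = Set.univ.pi fun i => {ω | truncate M a₀ ω = y i} := by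
  ext w
  simp [batchEvent]

variable [MeasurableSpace S] [MeasurableSpace A] [MeasurableSingletonClass S]
  [MeasurableSingletonClass A]

lemma measurableSet_batchEvent (y : Fin m → episodes M a₀ n) : MeasurableSet (batchEvent M y) :=
  batchEvent_eq_pi y ▸ .univ_pi fun i => measurableSet_truncate_eq_coe (y i)

variable [Finite S] [Finite A] {π : Policy d S A} {θ : Param d}

lemma batchLaw_batchEvent (y : Fin m → episodes M a₀ n) :
    batchLaw M π m θ (batchEvent M y) = ENNReal.ofReal (∏ i, episodeProb π θ (y i)) := by
  simp only [batchEvent_eq_pi, batchLaw, Measure.pi_pi, episodeProb]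
  rw [ENNReal.ofReal_prod_of_nonneg fun i _ => measureReal_nonneg]
  exact Finset.prod_congr rfl fun i _ => (ofReal_measureReal).symm

lemma ae_batchLaw_exists_mem_batchEvent (a₀ : A)
    (hlength : ∀ᵐ ω ∂episodeLaw M π θ, episodeLength M ω ≤ n) :
    ∀ᵐ w ∂batchLaw M π m θ, ∃ y : Fin m → episodes M a₀ n, w ∈ batchEvent M y := by
  have hall : ∀ᵐ w ∂batchLaw M π m θ, ∀ i, episodeLength M (w i) ≤ n := ae_all_iff.2 fun i =>
    (Measure.quasiMeasurePreserving_eval (μ := fun _ : Fin m => episodeLaw M π θ) i).ae hlength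
  filter_upwards [hall] with w hw
  exact ⟨fun i => ⟨_, truncate_mem_episodes (hw i)⟩, fun i => rfl⟩

end Batch

section Run

variable {S A : Type*} {d : ℕ} [Finite S] [Finite A] [MeasurableSpace S] [MeasurableSpace A]
  [MeasurableSingletonClass S] [MeasurableSingletonClass A] {M : EpisodicMDP S A}
  {π : Policy d S A} {g k : ℝ → ℝ} {N m n : ℕ} {α : ℝ} {θ₀ : Param d} {a₀ : A} {Ω : Type*}
  [mΩ : MeasurableSpace Ω] {P : Measure Ω} {ℱ : Filtration ℕ mΩ}
  {W : ℕ → Ω → Fin m → Trajectory S A} {θ : ℕ → Ω → Param d} {R : Ω → ℕ} {B C c : ℝ} {c' : ℝ≥0}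

namespace IsRun

variable (hrun : IsRun M π g N m α θ₀ P ℱ W θ R)
include hrun

lemma measurable_iterate_top {j : ℕ} (hj : j ≤ N) : Measurable (θ j) :=
  (hrun.measurable_iterate j hj).mono (ℱ.le j) le_rfl

lemma measurable_gradEstimate (hα : 0 < α) {j : ℕ} (hj : j < N) :
    Measurable fun ω => gradEstimate M π g (θ j ω) (W j ω) := by
  have heq : (fun ω => gradEstimate M π g (θ j ω) (W j ω)) =
      fun ω => α⁻¹ • (θ (j + 1) ω - θ j ω) := by
    funext ω
    rw [hrun.update j hj ω, add_sub_cancel_left, inv_smul_smul₀ hα.ne']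
  rw [heq]
  exact ((hrun.measurable_iterate_top hj).sub (hrun.measurable_iterate_top hj.le)).const_smul α⁻¹

lemma indepFun_index_iterate {j : ℕ} (hj : j ∈ Finset.Icc 1 N) : IndepFun R (θ j) P := by
  obtain ⟨i, rfl⟩ := Nat.exists_eq_add_of_le' (Finset.mem_Icc.1 hj).1
  exact hrun.index_indep.comp (ψ := fun x : Fin N → Param d => x ⟨i, (Finset.mem_Icc.1 hj).2⟩)
    measurable_id (measurable_pi_apply _)

lemma ae_batch_of_forall_ae {j : ℕ} (hj : j < N) {s : Set (Fin m → Trajectory S A)}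
    (hs : MeasurableSet s) (h : ∀ ϑ, ∀ᵐ w ∂batchLaw M π m ϑ, w ∈ s) : ∀ᵐ ω ∂P, W j ω ∈ s := by
  have hlaw := hrun.batch_law j hj Set.univ MeasurableSet.univ sᶜ hs.compl
  simp only [show ∀ ϑ, batchLaw M π m ϑ sᶜ = 0 from h, lintegral_zero, Set.univ_inter] at hlaw
  exact hlaw

lemma ae_exists_mem_batchEvent (a₀ : A)
    (hlength : ∀ ϑ, ∀ᵐ ω ∂episodeLaw M π ϑ, episodeLength M ω ≤ n) {j : ℕ} (hj : j < N) :
    ∀ᵐ ω ∂P, ∃ y : Fin m → episodes M a₀ n, W j ω ∈ batchEvent M y := by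
  simp only [← Set.mem_iUnion]
  refine hrun.ae_batch_of_forall_ae hj (.iUnion measurableSet_batchEvent) fun ϑ => ?_
  simpa only [Set.mem_iUnion] using ae_batchLaw_exists_mem_batchEvent a₀ (hlength ϑ)

lemma lintegral_le_lintegral_sum_batchEvent [IsProbabilityMeasure P]
    (hlength : ∀ ϑ, ∀ᵐ ω ∂episodeLaw M π ϑ, episodeLength M ω ≤ n)
    (hprob : ∀ y : episodes M a₀ n, Measurable fun ϑ => episodeProb π ϑ y) {j : ℕ} (hj : j < N)
    {Y : Ω → ℝ≥0∞} {F : (Fin m → episodes M a₀ n) → Param d → ℝ≥0∞} (hF : ∀ y, Measurable (F y))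
    (hY : ∀ y, ∀ ω, W j ω ∈ batchEvent M y → Y ω ≤ F y (θ j ω)) :
    ∫⁻ ω, Y ω ∂P ≤
      ∫⁻ ω, ∑ y, ENNReal.ofReal (∏ i, episodeProb π (θ j ω) (y i)) * F y (θ j ω) ∂P := by
  have hθ := hrun.measurable_iterate j hj.le
  refine lintegral_le_lintegral_sum_mul (D := fun y => W j ⁻¹' batchEvent M y) (ℱ.le j)
    (hrun.ae_exists_mem_batchEvent a₀ hlength hj) (fun y => ?_) (fun y => (hF y).comp hθ)
    (fun y E hE => ?_) hY
  · exact (Finset.measurable_prod _ fun i _ => (hprob (y i)).comp hθ).ennreal_ofReal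
  · rw [hrun.batch_law j hj E hE _ (measurableSet_batchEvent y)]
    simp only [batchLaw_batchEvent]

lemma lintegral_norm_gradEstimate_sub_sq_le [IsProbabilityMeasure P]
    (hlength : ∀ ϑ, ∀ᵐ ω ∂episodeLaw M π ϑ, episodeLength M ω ≤ n)
    (hp : HasBoundedScore (episodeProb (M := M) (a₀ := a₀) (n := n) π)
      (fun ϑ y => episodeScore M π ϑ y) B C)
    (hk : IsDistortionDeriv g k c c') (hm : 1 ≤ m) {j : ℕ} (hj : j < N) :
    ∫⁻ ω, ENNReal.ofReal
        (‖gradEstimate M π g (θ j ω) (W j ω) - drmGrad M π a₀ n k (θ j ω)‖ ^ 2) ∂P ≤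
      ENNReal.ofReal (2 * (2 * M.rewardBound) ^ 2 * B ^ 2 * (c ^ 2 + c' ^ 2) / m) := by
  set σ := 2 * (2 * M.rewardBound) ^ 2 * B ^ 2 * (c ^ 2 + c' ^ 2) / m with hσ
  let u (ϑ : Param d) (y : episodes M a₀ n) : Param d := episodeScore M π ϑ y
  let f (y : Fin m → episodes M a₀ n) (ϑ : Param d) : ℝ :=
    ‖finiteDRMGrad (rewardLength M a₀ n) k (empirical y) (u ϑ) -
      drmGrad M π a₀ n k ϑ‖ ^ 2
  have hf : ∀ y, Measurable (f y) := fun y => by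
    have hemp := continuous_finiteDRMGrad (len := rewardLength M a₀ n) (p := fun _ => empirical y)
      hk (fun _ => continuous_const) hp.continuous_score
    exact ((hemp.sub (lipschitzWith_drmGrad hp hk).continuous).norm.pow 2).measurable
  have hmean : ∀ ϑ, ∑ y, ENNReal.ofReal (∏ i, episodeProb π ϑ (y i)) * ENNReal.ofReal (f y ϑ) ≤
      ENNReal.ofReal σ := fun ϑ => by
    have hprod : ∀ y : Fin m → episodes M a₀ n, 0 ≤ ∏ i, episodeProb π ϑ (y i) :=
      fun y => Finset.prod_nonneg fun i _ => (hp.mem_stdSimplex ϑ).1 _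
    simp only [← ENNReal.ofReal_mul (hprod _)]
    rw [← ENNReal.ofReal_sum_of_nonneg fun y _ => mul_nonneg (hprod y) (sq_nonneg _), hσ,
      ← sum_rewardLength (a₀ := a₀) (n := n)]
    exact ENNReal.ofReal_le_ofReal (sum_prod_mul_norm_finiteDRMGrad_empirical_sub_sq_le
      rewardLength_nonneg hk (hp.mem_stdSimplex ϑ) (hp.norm_score_le ϑ) hm)
  calc _ ≤ ∫⁻ ω, ∑ y : Fin m → episodes M a₀ n,
        ENNReal.ofReal (∏ i, episodeProb π (θ j ω) (y i)) * ENNReal.ofReal (f y (θ j ω)) ∂P :=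
        hrun.lintegral_le_lintegral_sum_batchEvent hlength
          (fun y => (hp.continuous_weight y).measurable) hj (fun y => (hf y).ennreal_ofReal)
          fun y ω hω => by rw [gradEstimate_eq_finiteDRMGrad hk hm hω]
    _ ≤ ∫⁻ _, ENNReal.ofReal σ ∂P := lintegral_mono fun ω => hmean (θ j ω)
    _ = ENNReal.ofReal σ := by rw [lintegral_const, measure_univ, mul_one]

end IsRun

end Run

section Convergence

variable {S A : Type*} {d : ℕ} [Finite S] [Finite A] [MeasurableSpace S] [MeasurableSpace A]
  [MeasurableSingletonClass S] [MeasurableSingletonClass A] {M : EpisodicMDP S A}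
  {π : Policy d S A} {g k : ℝ → ℝ} {N m n : ℕ} {α : ℝ} {θ₀ : Param d} {a₀ : A} {Ω : Type*}
  [mΩ : MeasurableSpace Ω] {P : Measure Ω} [IsProbabilityMeasure P] {ℱ : Filtration ℕ mΩ}
  {W : ℕ → Ω → Fin m → Trajectory S A} {θ : ℕ → Ω → Param d} {R : Ω → ℕ} {B C c : ℝ} {c' : ℝ≥0}

theorem IsRun.integral_norm_sq_drmGrad_le (hrun : IsRun M π g N m α θ₀ P ℱ W θ R)
    (hlength : ∀ ϑ, ∀ᵐ ω ∂episodeLaw M π ϑ, episodeLength M ω ≤ n)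
    (hp : HasBoundedScore (episodeProb (M := M) (a₀ := a₀) (n := n) π)
      (fun ϑ y => episodeScore M π ϑ y) B C)
    (hg : Set.MapsTo g (Set.Icc 0 1) (Set.Icc 0 1)) (hk : IsDistortionDeriv g k c c')
    (hN : 1 ≤ N) (hm : 1 ≤ m) (hα : 0 < α) :
    Integrable (fun ω => ‖drmGrad M π a₀ n k (θ (R ω) ω)‖ ^ 2) P ∧
      ∫ ω, ‖drmGrad M π a₀ n k (θ (R ω) ω)‖ ^ 2 ∂P ≤
        2 * ((⨆ ϑ, drm M π g ϑ) - drm M π g θ₀) / (N * α) +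
          (α * (2 * M.rewardBound * (c * (B ^ 2 + C) + c' * B ^ 2)) *
              (2 * M.rewardBound * (c * B)) ^ 2 +
            2 * (2 * M.rewardBound) ^ 2 * B ^ 2 * (c ^ 2 + c' ^ 2) / m) := by
  have hMr := M.rewardBound_nonneg
  have hL : 0 ≤ 2 * M.rewardBound * (c * (B ^ 2 + C) + c' * B ^ 2) := by
    have hc : 0 ≤ c := (abs_nonneg _).trans (hk.abs_le 0 (Set.left_mem_Icc.2 zero_le_one))
    have hC := hp.nonneg.2
    positivity
  have hbdd := bddAbove_range_drm hp hlength hg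
  rw [← Real.coe_toNNReal _ hL]
  exact integral_norm_sq_gradient_comp_index_le (hasGradientAt_drm hp hlength hk)
    (lipschitzWith_drmGrad hp hk)
    (fun ϑ => ⟨(drm_mem_Icc hp hlength hg ϑ).1, le_ciSup hbdd ϑ⟩) (norm_drmGrad_le hp hk) hN hα
    (by positivity) hrun.init hrun.update (fun _ => hrun.measurable_iterate_top)
    (fun _ => hrun.measurable_gradEstimate hα)
    (fun _ => hrun.lintegral_norm_gradEstimate_sub_sq_le hlength hp hk hm)
    hrun.measurable_index hrun.index_uniform fun _ => hrun.indepFun_index_iterate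

end Convergence

lemma two_mul_sq_add_sq_le (a b : ℝ) :
    2 * (a ^ 2 + b ^ 2) ≤ 8 * (Real.exp 1 ^ 2 * a ^ 2 + b ^ 2) := by
  have hexp : 1 ≤ Real.exp 1 ^ 2 := one_le_pow₀ (Real.one_le_exp zero_le_one)
  nlinarith [sq_nonneg a, sq_nonneg b]

end DRM

theorem mainTheorem1_general
    {S A : Type*} [Finite S] [Finite A] [MeasurableSpace S] [MeasurableSpace A]
    [MeasurableSingletonClass S] [MeasurableSingletonClass A] {d : ℕ}
    (M : DRM.EpisodicMDP S A) (π : DRM.Policy d S A) (g : ℝ → ℝ) (Me Md Mh Mg' Mg'' : ℝ)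
    (hlength : ∀ θ, ∀ᵐ ω ∂(DRM.episodeLaw M π θ),
      ∃ n : ℕ, DRM.episodeLength M ω = n ∧ (n : ℝ) ≤ Me)
    (hpos : ∀ θ s a, π θ s a ≠ 0)
    (hdiff : ∀ s a, Differentiable ℝ (DRM.logPolicy π s a))
    (hdiff2 : ∀ s a, Differentiable ℝ (gradient (DRM.logPolicy π s a)))
    (hscore : ∀ θ s a, ‖gradient (DRM.logPolicy π s a) θ‖ ≤ Md)
    (hhess : ∀ θ s a, ‖fderiv ℝ (gradient (DRM.logPolicy π s a)) θ‖ ≤ Mh)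
    (hg : Set.MapsTo g (Set.Icc 0 1) (Set.Icc 0 1))
    (hg0 : ContinuousWithinAt g (Set.Icc 0 1) 0)
    (hg1 : ∀ t ∈ Set.Ioo (0 : ℝ) 1, DifferentiableAt ℝ g t ∧ |deriv g t| ≤ Mg')
    (hg2 : ∀ t ∈ Set.Ioo (0 : ℝ) 1,
      DifferentiableAt ℝ (deriv g) t ∧ |deriv (deriv g) t| ≤ Mg'')
    (N m : ℕ) (hN : 1 ≤ N) (hm : 1 ≤ m) (α : ℝ) (hα : 0 < α) (θ₀ : DRM.Param d)
    {Ω : Type*} [mΩ : MeasurableSpace Ω] (P : Measure Ω) [IsProbabilityMeasure P]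
    (ℱ : Filtration ℕ mΩ) (W : ℕ → Ω → Fin m → DRM.Trajectory S A) (θ : ℕ → Ω → DRM.Param d)
    (R : Ω → ℕ) (hrun : DRM.IsRun M π g N m α θ₀ P ℱ W θ R) :
    Differentiable ℝ (DRM.drm M π g) ∧
    BddAbove (Set.range (DRM.drm M π g)) ∧
    Integrable (fun ω => ‖gradient (DRM.drm M π g) (θ (R ω) ω)‖ ^ 2) P ∧
    ∫ ω, ‖gradient (DRM.drm M π g) (θ (R ω) ω)‖ ^ 2 ∂P ≤
      2 * ((⨆ ϑ, DRM.drm M π g ϑ) - DRM.drm M π g θ₀) / (N * α) +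
        4 * M.rewardBound ^ 2 * Me ^ 2 * Md ^ 2 *
          (α * Mg' ^ 2 * DRM.smoothConst M.rewardBound Me Md Mh Mg' Mg'' +
            2 * (Mg' ^ 2 + Mg'' ^ 2) / m) := by
  obtain ⟨a₀, -⟩ := (π 0 M.start).support_nonempty
  obtain ⟨n, hn, hp⟩ :=
    DRM.hasBoundedScore_episodeProb_of_ae_le a₀ hlength hpos hdiff hdiff2 hscore hhess
  lift Mg'' to NNReal using (abs_nonneg _).trans (hg2 (1 / 2) (by norm_num)).2
  obtain ⟨k, hk⟩ := DRM.exists_isDistortionDeriv hg0 hg1 hg2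
  have hgrad := DRM.hasGradientAt_drm hp hn hk
  obtain ⟨hint, hle⟩ := hrun.integral_norm_sq_drmGrad_le hn hp hg hk hN hm hα
  rw [funext fun ϑ => (hgrad ϑ).gradient]
  refine ⟨fun ϑ => (hgrad ϑ).differentiableAt, DRM.bddAbove_range_drm hp hn hg, hint,
    hle.trans_eq ?_⟩
  rw [DRM.smoothConst]
  ring

theorem mainTheorem1
    {S A : Type*} [Finite S] [Finite A] [MeasurableSpace S] [MeasurableSpace A]
    [MeasurableSingletonClass S] [MeasurableSingletonClass A] {d : ℕ}
    (M : DRM.EpisodicMDP S A) (π : DRM.Policy d S A) (g : ℝ → ℝ)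
    (Me Md Mh Mg' Mg'' : ℝ)
    (hMe : 0 < Me) (hMd : 0 < Md) (hMh : 0 < Mh) (hMg' : 0 < Mg') (hMg'' : 0 < Mg'')
    -- the policies are proper, and `Me` bounds the episode length
    (hproper : DRM.IsProper M π)
    (hlength : ∀ θ, ∀ᵐ ω ∂(DRM.episodeLaw M π θ),
      ∃ n : ℕ, DRM.episodeLength M ω = n ∧ (n : ℝ) ≤ Me)
    -- `log π_θ(a | s)` is defined and twice differentiable in `θ`, with bounded gradient and Hessian
    (hpos : ∀ θ s a, π θ s a ≠ 0)
    (hdiff : ∀ s a, Differentiable ℝ (DRM.logPolicy π s a))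
    (hdiff2 : ∀ s a, Differentiable ℝ (gradient (DRM.logPolicy π s a)))
    (hscore : ∀ θ s a, ‖gradient (DRM.logPolicy π s a) θ‖ ≤ Md)
    (hhess : ∀ θ s a, ‖fderiv ℝ (gradient (DRM.logPolicy π s a)) θ‖ ≤ Mh)
    -- the distortion function, with bounded first and second derivatives on `(0, 1)`
    (hg : DRM.IsDistortion g)
    (hg0 : DifferentiableWithinAt ℝ g (Set.Icc 0 1) 0)
    (hg1 : ∀ t ∈ Set.Ioo (0 : ℝ) 1, DifferentiableAt ℝ g t ∧ |deriv g t| ≤ Mg')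
    (hg2 : ∀ t ∈ Set.Ioo (0 : ℝ) 1,
      DifferentiableAt ℝ (deriv g) t ∧ |deriv (deriv g) t| ≤ Mg'')
    -- the run of the algorithm
    (N m : ℕ) (hN : 1 ≤ N) (hm : 1 ≤ m) (α : ℝ) (hα : 0 < α) (θ₀ : DRM.Param d)
    {Ω : Type*} [mΩ : MeasurableSpace Ω] (P : MeasureTheory.Measure Ω)
    [MeasureTheory.IsProbabilityMeasure P] (ℱ : MeasureTheory.Filtration ℕ mΩ)
    (W : ℕ → Ω → Fin m → DRM.Trajectory S A) (θ : ℕ → Ω → DRM.Param d) (R : Ω → ℕ)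
    (hrun : DRM.IsRun M π g N m α θ₀ P ℱ W θ R) :
    Differentiable ℝ (DRM.drm M π g) ∧
    BddAbove (Set.range (DRM.drm M π g)) ∧
    MeasureTheory.Integrable (fun ω => ‖gradient (DRM.drm M π g) (θ (R ω) ω)‖ ^ 2) P ∧
    ∫ ω, ‖gradient (DRM.drm M π g) (θ (R ω) ω)‖ ^ 2 ∂P ≤
      2 * ((⨆ ϑ, DRM.drm M π g ϑ) - DRM.drm M π g θ₀) / (N * α) +
        4 * M.rewardBound ^ 2 * Me ^ 2 * Md ^ 2 *
          (α * Mg' ^ 2 * DRM.smoothConst M.rewardBound Me Md Mh Mg' Mg'' +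
            8 * (Real.exp 1 ^ 2 * Mg' ^ 2 + Mg'' ^ 2) / m) := by
  obtain ⟨hdrm, hbdd, hint, hle⟩ := mainTheorem1_general M π g Me Md Mh Mg' Mg'' hlength hpos hdiff
    hdiff2 hscore hhess hg.mapsTo hg0.continuousWithinAt hg1 hg2 N m hN hm α hα θ₀ P ℱ W θ R hrun
  refine ⟨hdrm, hbdd, hint, hle.trans ?_⟩
  gcongr _ + _ * (_ + ?_ / _)
  exact DRM.two_mul_sq_add_sq_le Mg' Mg''
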